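/- Let $d\ge 1$, $N\in\mathbb N$, let $\mathbb T^d=\mathbb R^d/\mathbb Z^d$ be the flat torus with Lebesgue measure $d\xi$, $H=L^2(\mathbb T^d)$, $S=H^1(\mathbb T^d)$. Let $a=(a_{lj})\colon\mathbb T^d\to\mathbb R^{d\times d}$ and $b=(b_{ij})\colon\mathbb T^d\to\mathbb R^{N\times d}$ be of class $C^2$, let $b_i$ be the rows of $b$, and assume: (E) there is $\kappa>0$ with $|a(\xi)\zeta|^2\ge\kappa|\zeta|^2$ for all $\zeta\in\mathbb R^d$, $\xi\in\mathbb T^d$; (R) for all $1\le l,j\le d$, $1\le i\le N$, on $\mathbb T^d$, $$\sum_{k=1}^d\sum_{p=1}^d\bigl[b_{ik}(a_{pl}\partial_k a_{pj}+a_{pj}\partial_k a_{pl})-a_{pk}(a_{pj}\partial_k b_{il}+a_{pl}\partial_k b_{ij})\bigr]=0;$$ (D) $\operatorname{div} b_i=0$ on $\mathbb T^d$ for all $1\le i\le N$. For $\ell\in\{a,b\}$ let $L^\ell$ be the (nonpositive self-adjoint) Dirichlet operator in $H$ associated to the form $(u,v)\mapsto\int_{\mathbb T^d}\langle \ell\nabla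 u,\ell\nabla v\rangle\,d\xi$, $u,v\in S$ (formally $L^\ell u=\operatorname{div}(\ell^*\ell\nabla u)$), and write $\mathcal A$ for the form with $\ell=a$. For $\beta,\delta>0$ let $G_\beta=(\beta-L^a)^{-1}$ and $J_\delta=(1-\delta L^a)^{-1}$ be resolvents of $L^a$ on $H$, and for $\alpha\ge 0$, $u,v\in H$ put $$\mathcal A^{(\beta)}_\alpha(u,v)=\beta\,(u-\beta G_\beta u,v)_H+\alpha\,(u,v)_H .$$ Then there is a constant $c\in\mathbb R$ (independent of $u,\delta,\beta,\alpha$) such that: 1. for all $u\in H$, $\delta,\beta>0$, $\alpha\ge0$, one has $J_\delta u\in D(L^b)$ and $$\sum_{i=1}^N\mathcal A^{(\beta)}_\alpha\bigl(\langle b_i,\nabla J_\delta u\rangle,\langle b_i,\nabla J_\delta u\rangle\bigr)+\mathcal A^{(\beta)}_\alpha\bigl(J_\delta L^bJ_\delta u,u\bigr)\le -c\,\mathcal A(J_\delta u,J_\delta u);$$ 2. for all $u\in S$, $\delta,\beta>0$, $\alpha\ge0$, $$\mathcal A^{(\beta)}_\alpha\bigl(u,J_\delta L^bJ_\delta u\bigr)\le\max(-c,0)\,\mathcal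 A(u,u).$$ -/

import Mathlib

open MeasureTheory

noncomputable section

namespace TorusForms

/-- The flat torus `𝕋^d = ℝ^d / ℤ^d`; its `volume` is the Lebesgue (probability) measure. -/
abbrev Torus (d : ℕ) : Type := UnitAddTorus (Fin d)

/-- The quotient map `ℝ^d → 𝕋^d`. -/
def toTorus {d : ℕ} (x : Fin d → ℝ) : Torus d := fun k => (x k : UnitAddCircle)

/-- `f ∈ C^n(𝕋^d)`: the periodic lift of `f` to `ℝ^d` is of class `C^n`. -/
def IsCk {d : ℕ} (n : WithTop ℕ∞) (f : Torus d → ℝ) : Prop :=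
  ContDiff ℝ n (fun x : Fin d → ℝ => f (toTorus x))

/-- The classical partial derivative `∂_k f (ξ)` of a function on the torus. -/
def pderiv {d : ℕ} (k : Fin d) (f : Torus d → ℝ) (ξ : Torus d) : ℝ :=
  deriv (fun t : ℝ => f (ξ + Pi.single k (t : UnitAddCircle))) 0

/-- `H = L²(𝕋^d)`. -/
abbrev H (d : ℕ) : Type := Lp ℝ 2 (volume : Measure (Torus d))

/-- `g ∈ L²` is the weak partial derivative `∂_k u` of `u ∈ L²`
(tested against smooth functions on the torus). -/
def IsWeakDeriv {d : ℕ} (k : Fin d) (u g : H d) : Prop :=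
  ∀ φ : Torus d → ℝ, IsCk (⊤ : ℕ∞) φ → ∫ ξ, u ξ * pderiv k φ ξ = -∫ ξ, g ξ * φ ξ

/-- `S = H¹(𝕋^d)`, as a set of elements of `L²(𝕋^d)`. -/
def H1 (d : ℕ) : Set (H d) := {u | ∀ k : Fin d, ∃ g : H d, IsWeakDeriv k u g}

open Classical in
/-- The weak partial derivative `∂_k u ∈ L²(𝕋^d)` (meaningful for `u ∈ H¹`). -/
def weakDeriv {d : ℕ} (k : Fin d) (u : H d) : H d :=
  if h : ∃ g : H d, IsWeakDeriv k u g then h.choose else 0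

/-- The function `(ℓ ∇u)_i = ⟨ℓ_i, ∇u⟩` on the torus, `ℓ_i` being the `i`-th row of the matrix
field `ℓ`. -/
def rowGrad {d m : ℕ} (l : Torus d → Matrix (Fin m) (Fin d) ℝ) (i : Fin m) (u : H d)
    (ξ : Torus d) : ℝ :=
  ∑ j : Fin d, l ξ i j * weakDeriv j u ξ

open Classical in
/-- The class in `L²(𝕋^d)` of a square integrable function. -/
def toH {d : ℕ} (f : Torus d → ℝ) : H d :=
  if h : MemLp f 2 (volume : Measure (Torus d)) then h.toLp f else 0

/-- `⟨ℓ_i, ∇u⟩` as an element of `L²(𝕋^d)`. -/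
def rowGradH {d m : ℕ} (l : Torus d → Matrix (Fin m) (Fin d) ℝ) (i : Fin m) (u : H d) : H d :=
  toH (rowGrad l i u)

/-- The form `𝓛^ℓ(u,v) = ∫ ⟨ℓ∇u, ℓ∇v⟩ dξ`, `u, v ∈ H¹(𝕋^d)`. -/
def form {d m : ℕ} (l : Torus d → Matrix (Fin m) (Fin d) ℝ) (u v : H d) : ℝ :=
  ∫ ξ : Torus d, ∑ i : Fin m, rowGrad l i u ξ * rowGrad l i v ξ

/-- `L^ℓ v = f`, where `L^ℓ` is the operator in `L²(𝕋^d)` associated to the form `𝓛^ℓ` with domain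
`H¹(𝕋^d)`. (If `ℓ` degenerates, the form is only closable on `H¹`. The operator of its closure has
the same elements of `H¹` in its domain and the same values on them, as `H¹` is a form core.) -/
def IsDirichletOp {d m : ℕ} (l : Torus d → Matrix (Fin m) (Fin d) ℝ) (v f : H d) : Prop :=
  v ∈ H1 d ∧ ∀ w ∈ H1 d, form l v w = -inner ℝ f w

/-- The elements of `H¹(𝕋^d)` that lie in the domain `D(L^ℓ)`. -/
def opDomain {d m : ℕ} (l : Torus d → Matrix (Fin m) (Fin d) ℝ) : Set (H d) :=
  {v | ∃ f : H d, IsDirichletOp l v f}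

open Classical in
/-- The value `L^ℓ v ∈ L²(𝕋^d)` (meaningful for `v ∈ D(L^ℓ)`). -/
def dirichletOp {d m : ℕ} (l : Torus d → Matrix (Fin m) (Fin d) ℝ) (v : H d) : H d :=
  if h : ∃ f : H d, IsDirichletOp l v f then h.choose else 0

open Classical in
/-- The resolvent `G_β^ℓ u = (β - L^ℓ)⁻¹ u`. -/
def resolventG {d m : ℕ} (l : Torus d → Matrix (Fin m) (Fin d) ℝ) (β : ℝ) (u : H d) : H d :=
  if h : ∃ v ∈ opDomain l, β • v - dirichletOp l v = u then h.choose else 0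

open Classical in
/-- The resolvent `J_δ^ℓ u = (1 - δ L^ℓ)⁻¹ u`. -/
def resolventJ {d m : ℕ} (l : Torus d → Matrix (Fin m) (Fin d) ℝ) (δ : ℝ) (u : H d) : H d :=
  if h : ∃ v ∈ opDomain l, v - δ • dirichletOp l v = u then h.choose else 0

/-- The approximate form
`𝓛^{ℓ,(β)}_α(u,v) = β (u - β G_β^ℓ u, v)_H + α (u,v)_H`, `u, v ∈ L²(𝕋^d)`. -/
def approxForm {d m : ℕ} (l : Torus d → Matrix (Fin m) (Fin d) ℝ) (α β : ℝ) (u v : H d) : ℝ :=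
  β * inner ℝ (u - β • resolventG l β u) v + α * inner ℝ u v

/-- A matrix field of class `C^n` on the torus. -/
def IsCkField {d m : ℕ} (n : WithTop ℕ∞) (l : Torus d → Matrix (Fin m) (Fin d) ℝ) : Prop :=
  ∀ i j, IsCk n (fun ξ => l ξ i j)

/-- Condition (E): `a ∈ C¹` and `|a(ξ)ζ|² ≥ κ|ζ|²` for some `κ > 0` (Euclidean norms). -/
def CondE {d : ℕ} (a : Torus d → Matrix (Fin d) (Fin d) ℝ) : Prop :=
  IsCkField 1 a ∧
    ∃ κ : ℝ, 0 < κ ∧ ∀ (ζ : Fin d → ℝ) (ξ : Torus d),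
      κ * ∑ j, ζ j ^ 2 ≤ ∑ i, (Matrix.mulVec (a ξ) ζ i) ^ 2

/-- Condition (D): `b ∈ C¹` and the rows of `b` are divergence free. -/
def CondD {d N : ℕ} (b : Torus d → Matrix (Fin N) (Fin d) ℝ) : Prop :=
  IsCkField 1 b ∧
    ∀ (i : Fin N) (ξ : Torus d), ∑ j : Fin d, pderiv j (fun η => b η i j) ξ = 0

/-- Condition (R): `a, b ∈ C²` and the commutation identity for the coefficients. -/
def CondR {d N : ℕ} (a : Torus d → Matrix (Fin d) (Fin d) ℝ)
    (b : Torus d → Matrix (Fin N) (Fin d) ℝ) : Prop :=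
  IsCkField 2 a ∧ IsCkField 2 b ∧
    ∀ (l j : Fin d) (i : Fin N) (ξ : Torus d),
      ∑ k : Fin d, ∑ p : Fin d,
        (b ξ i k * (a ξ p l * pderiv k (fun η => a η p j) ξ
            + a ξ p j * pderiv k (fun η => a η p l) ξ)
          - a ξ p k * (a ξ p j * pderiv k (fun η => b η i l) ξ
            + a ξ p l * pderiv k (fun η => b η i j) ξ)) = 0

end TorusForms

end

open TorusForms

/-! Write $B_i u=\langle b_i,\nabla u\rangle$. The constant is $c=0$, and item 1 then holds with
equality, because each $B_i$ commutes with the resolvents of $L^a$.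

By (D), $B_i$ is skew-symmetric in $L^2$ (`inner_rowGradH`). By (R) and (D) it is also
skew-symmetric for $\mathcal A$ on functions with two weak derivatives
(`form_rowGradH_add_form_rowGradH`): after one integration by parts the second-order terms cancel,
and the remaining coefficients are the expression in (R) up to sign and a divergence term. The two
skew-symmetries give $B_iG_\beta=G_\beta B_i$ on $H^1$ (`IsRes.rowGradH`).

Put $v=J_\delta u$. Elliptic regularity (`IsRes.weakDeriv_mem_H1`) puts $v$ in $H^2$, so
$L^bv=\sum_i B_iB_iv$. Since $J_\delta$ is symmetric and commutes with $G_\beta$, $$\mathcal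
A^{(\beta)}_\alpha(J_\delta L^bv,u)=\mathcal A^{(\beta)}_\alpha(L^bv,v)=-\sum_i\mathcal
A^{(\beta)}_\alpha(B_iv,B_iv).$$ This is item 1. Item 2 follows because $\mathcal
A^{(\beta)}_\alpha$ is symmetric and nonnegative.

The analysis rests on translations: weak derivatives coincide with $L^2$-derivatives of translates
(`isWeakDeriv_iff_hasD`), so the product rule, integration by parts and closedness become statements
about derivatives of curves in a Hilbert space. Resolvents are handled through the weak equation
`IsRes`, solved by Lax–Milgram (`exists_isRes`). -/

noncomputable section

namespace TorusForms

open Filter Topology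

variable {d : ℕ}

/-! ### Functions of class `C^n` on the torus -/

theorem smooth_add_one_le :
    (((⊤ : ℕ∞) : WithTop ℕ∞) + 1) ≤ ((⊤ : ℕ∞) : WithTop ℕ∞) := le_rfl

theorem isOpenQuotientMap_toTorus : IsOpenQuotientMap (toTorus (d := d)) :=
  IsOpenQuotientMap.piMap (f := fun (_ : Fin d) (x : ℝ) => (x : UnitAddCircle))
    fun _ => QuotientAddGroup.isOpenQuotientMap_mk

theorem IsCk.continuous {n : WithTop ℕ∞} {f : Torus d → ℝ} (hf : IsCk n f) : Continuous f :=
  (isOpenQuotientMap_toTorus.isQuotientMap.continuous_iff).2 (ContDiff.continuous hf)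

theorem toTorus_add (x y : Fin d → ℝ) : toTorus (x + y) = toTorus x + toTorus y := by
  ext k; simp [toTorus]

theorem toTorus_single (k : Fin d) (t : ℝ) :
    toTorus (Pi.single k t) = Pi.single k (t : UnitAddCircle) := by
  ext j
  by_cases h : j = k
  · subst h; simp [toTorus]
  · simp [toTorus, h]

/-- The translation `ξ ↦ ξ + t e_k` of the torus. -/
def shift (k : Fin d) (t : ℝ) : C(Torus d, Torus d) :=
  ⟨fun ξ => ξ + Pi.single k (t : UnitAddCircle), by fun_prop⟩

theorem shift_apply (k : Fin d) (t : ℝ) (ξ : Torus d) :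
    shift k t ξ = ξ + Pi.single k (t : UnitAddCircle) := rfl

theorem shift_add (k : Fin d) (s t : ℝ) (ξ : Torus d) :
    shift k (s + t) ξ = shift k s (shift k t ξ) := by
  simp only [shift_apply, AddCircle.coe_add, Pi.single_add]
  abel

theorem shift_comm (k j : Fin d) (s t : ℝ) (ξ : Torus d) :
    shift k s (shift j t ξ) = shift j t (shift k s ξ) := by
  simp only [shift_apply]
  abel

theorem shift_zero (k : Fin d) : shift k 0 = ContinuousMap.id (Torus d) := by
  ext1 ξ; simp [shift_apply]

theorem continuous_shift (k : Fin d) : Continuous fun t : ℝ => shift k t := by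
  refine ContinuousMap.continuous_of_continuous_uncurry _ ?_
  change Continuous fun p : ℝ × Torus d => p.2 + Pi.single k (p.1 : UnitAddCircle)
  have h : Continuous fun p : ℝ × Torus d => (Pi.single k (p.1 : UnitAddCircle) : Torus d) :=
    (continuous_single k).comp ((AddCircle.continuous_mk' 1).comp continuous_fst)
  exact continuous_snd.add h

theorem shift_toTorus (k : Fin d) (t : ℝ) (x : Fin d → ℝ) :
    shift k t (toTorus x) = toTorus (x + Pi.single k t) := by
  rw [toTorus_add, toTorus_single, shift_apply]

theorem IsCk.shift {n : WithTop ℕ∞} {f : Torus d → ℝ} (hf : IsCk n f) (k : Fin d) (t : ℝ) :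
    IsCk n (fun ξ => f (shift k t ξ)) := by
  unfold IsCk at *
  simp only [shift_toTorus]
  exact hf.comp (contDiff_id.add contDiff_const)

theorem IsCk.const (n : WithTop ℕ∞) (r : ℝ) : IsCk n (fun _ : Torus d => r) := contDiff_const

theorem IsCk.add {n : WithTop ℕ∞} {f g : Torus d → ℝ} (hf : IsCk n f) (hg : IsCk n g) :
    IsCk n (fun ξ => f ξ + g ξ) := ContDiff.add hf hg

theorem IsCk.mul {n : WithTop ℕ∞} {f g : Torus d → ℝ} (hf : IsCk n f) (hg : IsCk n g) :
    IsCk n (fun ξ => f ξ * g ξ) := ContDiff.mul hf hg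

theorem IsCk.hasDerivAt_shift {n : WithTop ℕ∞} (hn : n ≠ 0) {f : Torus d → ℝ} (hf : IsCk n f)
    (k : Fin d) (ξ : Torus d) (t : ℝ) :
    HasDerivAt (fun s => f (TorusForms.shift k s ξ)) (pderiv k f (TorusForms.shift k t ξ)) t := by
  have key : ∀ η : Torus d, HasDerivAt (fun s => f (TorusForms.shift k s η)) (pderiv k f η) 0 := by
    intro η
    have : DifferentiableAt ℝ (fun s => f (TorusForms.shift k s η)) 0 := by
      obtain ⟨x, rfl⟩ := isOpenQuotientMap_toTorus.surjective η
      simp only [shift_toTorus]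
      have h1 : DifferentiableAt ℝ (fun s : ℝ => x + Pi.single k s) 0 := by
        refine (differentiableAt_const _).add ?_
        exact (ContinuousLinearMap.single ℝ (fun _ : Fin d => ℝ) k).differentiableAt
      exact ((ContDiff.differentiable hf hn) _).comp 0 h1
    exact this.hasDerivAt
  have h := key (TorusForms.shift k t ξ)
  have h2 : HasDerivAt (fun s : ℝ => s - t) 1 t := (hasDerivAt_id t).sub_const t
  have h3 := HasDerivAt.comp (h₂ := fun s => f (TorusForms.shift k s (TorusForms.shift k t ξ)))
    (h := fun s : ℝ => s - t) t (by simpa using h) h2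
  have h4 : ((fun s => f (TorusForms.shift k s (TorusForms.shift k t ξ))) ∘ fun s : ℝ => s - t)
      = fun s => f (TorusForms.shift k s ξ) := by
    funext s
    simp only [Function.comp, ← shift_add, sub_add_cancel]
  rw [h4] at h3
  simpa using h3

theorem IsCk.pderiv {m n : WithTop ℕ∞} (hmn : m + 1 ≤ n) {f : Torus d → ℝ} (hf : IsCk n f)
    (k : Fin d) : IsCk m (TorusForms.pderiv k f) := by
  have hn : n ≠ 0 := by
    rintro rfl
    exact absurd (le_trans le_add_self hmn) (by norm_num)
  have h : (fun x : Fin d → ℝ => TorusForms.pderiv k f (toTorus x)) =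
      fun x => fderiv ℝ (fun x : Fin d → ℝ => f (toTorus x)) x (Pi.single k 1) := by
    funext x
    have h1 : HasDerivAt (fun s : ℝ => x + Pi.single k s) (Pi.single k 1) 0 := by
      have := ((ContinuousLinearMap.single ℝ (fun _ : Fin d => ℝ) k).hasDerivAt (x := (0 : ℝ)))
      simpa using this.const_add x
    have h2 := (((ContDiff.differentiable hf hn) (x + Pi.single k (0 : ℝ))).hasFDerivAt).comp_hasDerivAt
      0 h1
    have h3 := hf.hasDerivAt_shift hn k (toTorus x) 0
    simp only [shift_toTorus] at h3
    simpa using h3.unique h2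
  unfold IsCk
  rw [h]
  exact (ContDiff.fderiv_right hf hmn).clm_apply contDiff_const

theorem pderiv_shift {n : WithTop ℕ∞} (hn : n ≠ 0) {f : Torus d → ℝ} (hf : IsCk n f)
    (k : Fin d) (t : ℝ) (ξ : Torus d) :
    pderiv k (fun η => f (shift k t η)) ξ = pderiv k f (shift k t ξ) := by
  have h1 := (hf.shift k t).hasDerivAt_shift hn k ξ 0
  have h2 := hf.hasDerivAt_shift hn k (shift k t ξ) 0
  simp only [shift_comm k k t, shift_zero, ContinuousMap.id_apply] at h1 h2
  exact h1.unique h2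

/-- Translation of continuous functions. -/
def trC (k : Fin d) (t : ℝ) (c : C(Torus d, ℝ)) : C(Torus d, ℝ) := c.comp (shift k t)

theorem trC_apply (k : Fin d) (t : ℝ) (c : C(Torus d, ℝ)) (ξ : Torus d) :
    trC k t c ξ = c (shift k t ξ) := rfl

theorem trC_zero (k : Fin d) (c : C(Torus d, ℝ)) : trC k 0 c = c := by
  ext ξ; simp [trC_apply, shift_zero]

/-- `c'` is the `k`-th partial derivative of `c`, in the sense of uniform convergence of
the difference quotients. -/
def HasPD (k : Fin d) (c c' : C(Torus d, ℝ)) : Prop := HasDerivAt (fun t => trC k t c) c' 0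

theorem HasPD.mul {k : Fin d} {c c' e e' : C(Torus d, ℝ)} (hc : HasPD k c c') (he : HasPD k e e') :
    HasPD k (c * e) (c' * e + c * e') := by
  have h := HasDerivAt.mul (𝕜 := ℝ) hc he
  simp only [trC_zero] at h
  exact h

theorem HasPD.sum {ι : Type*} {s : Finset ι} {k : Fin d} {c c' : ι → C(Torus d, ℝ)}
    (hc : ∀ i ∈ s, HasPD k (c i) (c' i)) : HasPD k (∑ i ∈ s, c i) (∑ i ∈ s, c' i) := by
  have h := HasDerivAt.fun_sum hc
  have e : (fun t => ∑ i ∈ s, trC k t (c i)) = fun t => trC k t (∑ i ∈ s, c i) := by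
    funext t
    ext ξ
    simp [trC_apply, ContinuousMap.sum_apply]
  rw [e] at h
  exact h

/-- The continuous function on the torus underlying a function of class `C^n`. -/
def IsCk.toC {n : WithTop ℕ∞} {f : Torus d → ℝ} (hf : IsCk n f) : C(Torus d, ℝ) :=
  ⟨f, hf.continuous⟩

theorem IsCk.toC_apply {n : WithTop ℕ∞} {f : Torus d → ℝ} (hf : IsCk n f) (ξ : Torus d) :
    hf.toC ξ = f ξ := rfl

/-- Translation is continuous in the sup norm, so `∂_k f` changes by at most `ε` along short shifts,
uniformly in `ξ`. The mean value inequality for `s ↦ f (ξ + s e_k) - s ∂_k f ξ` turns this into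
uniform convergence of the difference quotients. -/
theorem IsCk.hasPD {m n : WithTop ℕ∞} (hmn : m + 1 ≤ n) {f : Torus d → ℝ} (hf : IsCk n f)
    (k : Fin d) : HasPD k hf.toC (hf.pderiv hmn k).toC := by
  have hn : n ≠ 0 := by
    rintro rfl
    exact absurd (le_trans le_add_self hmn) (by norm_num)
  set g := (hf.pderiv hmn k).toC with hg
  have hcont : Tendsto (fun t => trC k t g) (𝓝 0) (𝓝 g) := by
    have : Continuous fun t => trC k t g :=
      (ContinuousMap.continuous_postcomp g).comp (continuous_shift k)
    simpa [trC_zero] using this.tendsto 0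
  unfold HasPD
  rw [hasDerivAt_iff_isLittleO, Asymptotics.isLittleO_iff]
  intro ε hε
  obtain ⟨r, hr, hball⟩ := Metric.eventually_nhds_iff_ball.1
    (hcont.eventually (Metric.ball_mem_nhds g hε))
  refine Metric.eventually_nhds_iff_ball.2 ⟨r, hr, fun t ht => ?_⟩
  rw [ContinuousMap.norm_le _ (by positivity)]
  intro ξ
  have hmv := Convex.norm_image_sub_le_of_norm_hasDerivWithin_le
    (f := fun s => f (TorusForms.shift k s ξ) - s * g ξ)
    (f' := fun s => g (TorusForms.shift k s ξ) - g ξ) (s := Metric.ball 0 r) (C := ε)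
    (fun s _ => ((hf.hasDerivAt_shift hn k ξ s).sub
      (by simpa using (hasDerivAt_id s).mul_const (g ξ))).hasDerivWithinAt)
    (fun s hs => by
      have h1 := hball s hs
      rw [dist_eq_norm] at h1
      exact ((trC k s g - g).norm_coe_le_norm ξ).trans h1.le)
    (convex_ball 0 r) (Metric.mem_ball_self hr) ht
  refine le_trans (le_of_eq ?_) hmv
  congr 1
  simp only [ContinuousMap.sub_apply, trC_apply, ContinuousMap.smul_apply, sub_zero, smul_eq_mul,
    shift_zero, ContinuousMap.id_apply, zero_mul, IsCk.toC_apply]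
  ring

/-! ### Density of smooth functions -/

/-- The algebra of smooth functions on the torus. -/
def smoothAlg (d : ℕ) : Subalgebra ℝ C(Torus d, ℝ) where
  carrier := {c | IsCk (⊤ : ℕ∞) c}
  mul_mem' {a b} ha hb := IsCk.mul (n := (⊤ : ℕ∞)) (f := a) (g := b) ha hb
  add_mem' {a b} ha hb := IsCk.add (n := (⊤ : ℕ∞)) (f := a) (g := b) ha hb
  algebraMap_mem' r := IsCk.const (⊤ : ℕ∞) r

/-- The real and imaginary parts of the character `exp (2πi ξ_k)` are smooth and together determine
`ξ_k`. -/
theorem smoothAlg_separatesPoints : (smoothAlg d).SeparatesPoints := by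
  intro ξ η hne
  obtain ⟨k, hk⟩ := Function.ne_iff.1 hne
  have hk' : (AddCircle.toCircle (ξ k) : ℂ) ≠ AddCircle.toCircle (η k) := fun h =>
    hk (AddCircle.injective_toCircle one_ne_zero (Circle.ext h))
  have hs : ContDiff ℝ (⊤ : ℕ∞) fun x : Fin d → ℝ =>
      (AddCircle.toCircle (toTorus x k) : ℂ) := by
    simp only [toTorus, AddCircle.toCircle_apply_mk, Circle.coe_exp]
    exact ((Complex.ofRealCLM.contDiff.comp (by fun_prop : ContDiff ℝ (⊤ : ℕ∞)
      fun x : Fin d → ℝ => 2 * Real.pi / 1 * x k)).mul contDiff_const).cexp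
  have hre : IsCk (⊤ : ℕ∞) fun ξ : Torus d => (AddCircle.toCircle (ξ k) : ℂ).re :=
    Complex.reCLM.contDiff.comp hs
  have him : IsCk (⊤ : ℕ∞) fun ξ : Torus d => (AddCircle.toCircle (ξ k) : ℂ).im :=
    Complex.imCLM.contDiff.comp hs
  by_contra hcon
  apply hk'
  have h : ∀ c ∈ smoothAlg d, c ξ = c η := by
    intro c hc
    by_contra h
    exact hcon ⟨c, ⟨c, hc, rfl⟩, h⟩
  exact Complex.ext (h hre.toC hre) (h him.toC him)

/-- A continuous function as an element of `L²`. -/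
def ofC (c : C(Torus d, ℝ)) : H d := ContinuousMap.toLp 2 volume ℝ c

theorem coeFn_ofC (c : C(Torus d, ℝ)) : ofC c =ᵐ[volume] c := ContinuousMap.coeFn_toLp _ c

/-- Stone–Weierstrass gives sup-norm density in the continuous functions, which are dense in `L²`.
-/
theorem dense_smooth : Dense (ofC '' (smoothAlg d : Set C(Torus d, ℝ))) := by
  have h1 : Dense (smoothAlg d : Set C(Torus d, ℝ)) := by
    rw [dense_iff_closure_eq, ← Subalgebra.topologicalClosure_coe,
      ContinuousMap.subalgebra_topologicalClosure_eq_top_of_separatesPoints _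
        smoothAlg_separatesPoints]
    rfl
  exact (ContinuousMap.toLp_denseRange ℝ volume ℝ (by norm_num)).dense_image
    (ContinuousMap.toLp 2 volume ℝ).continuous h1

theorem eq_of_inner_smooth {u v : H d}
    (h : ∀ c ∈ smoothAlg d, inner ℝ u (ofC c) = inner ℝ v (ofC c)) : u = v := by
  refine ext_inner_right ℝ fun w => ?_
  have : (fun w : H d => inner ℝ u w) = fun w => inner ℝ v w :=
    Continuous.ext_on dense_smooth (by fun_prop) (by fun_prop) (by rintro _ ⟨c, hc, rfl⟩; exact h c hc)
  exact congrFun this w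

end TorusForms

end

noncomputable section

namespace TorusForms

open Filter Topology

variable {d : ℕ}

/-! ### Multiplication and translation operators on `L²` -/

theorem inner_eq_integral (u v : H d) : inner ℝ u v = ∫ ξ, u ξ * v ξ := by
  rw [L2.inner_def]
  simp only [RCLike.inner_apply, conj_trivial, mul_comm]

/-- Multiplication by a continuous function as a bounded operator on `L²`. -/
def mulH : C(Torus d, ℝ) →L[ℝ] H d →L[ℝ] H d :=
  ((ContinuousLinearMap.mul ℝ ℝ).holderL volume ⊤ 2 2).comp (ContinuousMap.toLp ⊤ volume ℝ)

theorem coeFn_mulH (c : C(Torus d, ℝ)) (u : H d) : mulH c u =ᵐ[volume] fun ξ => c ξ * u ξ := by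
  have h := (ContinuousLinearMap.mul ℝ ℝ).coeFn_holder (r := 2)
    (ContinuousMap.toLp ⊤ (volume : Measure (Torus d)) ℝ c) u
  have h2 := ContinuousMap.coeFn_toLp (p := ⊤) (𝕜 := ℝ) (volume : Measure (Torus d)) c
  filter_upwards [h, h2] with ξ h1 h2
  rw [h2] at h1
  exact h1

theorem mulH_mul (c e : C(Torus d, ℝ)) (u : H d) : mulH (c * e) u = mulH c (mulH e u) := by
  apply Lp.ext
  filter_upwards [coeFn_mulH (c * e) u, coeFn_mulH c (mulH e u), coeFn_mulH e u] with ξ h1 h2 h3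
  rw [h1, h2, h3, ContinuousMap.mul_apply, mul_assoc]

theorem inner_mulH (c : C(Torus d, ℝ)) (u v : H d) :
    inner ℝ (mulH c u) v = inner ℝ u (mulH c v) := by
  rw [inner_eq_integral, inner_eq_integral]
  apply integral_congr_ae
  filter_upwards [coeFn_mulH c u, coeFn_mulH c v] with ξ h1 h2
  rw [h1, h2]
  ring

theorem measurePreserving_shift (k : Fin d) (t : ℝ) :
    MeasurePreserving (shift k t) (volume : Measure (Torus d)) volume :=
  measurePreserving_add_right volume _

/-- Translation by `t e_k` as an isometry of `L²`. -/
def tr (k : Fin d) (t : ℝ) : H d →ₗᵢ[ℝ] H d :=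
  Lp.compMeasurePreservingₗᵢ ℝ (shift k t) (measurePreserving_shift k t)

theorem coeFn_tr (k : Fin d) (t : ℝ) (u : H d) :
    tr k t u =ᵐ[volume] fun ξ => u (shift k t ξ) :=
  Lp.coeFn_compMeasurePreserving u (measurePreserving_shift k t)

theorem coeFn_tr_tr (k j : Fin d) (s t : ℝ) (u : H d) :
    tr k s (tr j t u) =ᵐ[volume] fun ξ => u (shift j t (shift k s ξ)) := by
  filter_upwards [coeFn_tr k s (tr j t u),
    (measurePreserving_shift k s).quasiMeasurePreserving.ae (coeFn_tr j t u)] with ξ h1 h2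
  rw [h1, h2]

theorem tr_add (k : Fin d) (s t : ℝ) (u : H d) : tr k (s + t) u = tr k s (tr k t u) := by
  apply Lp.ext
  filter_upwards [coeFn_tr_tr k k s t u, coeFn_tr k (s + t) u] with ξ h1 h2
  rw [h1, h2, add_comm, shift_add]

theorem tr_comm (k j : Fin d) (s t : ℝ) (u : H d) : tr k s (tr j t u) = tr j t (tr k s u) := by
  apply Lp.ext
  filter_upwards [coeFn_tr_tr k j s t u, coeFn_tr_tr j k t s u] with ξ h1 h2
  rw [h1, h2, shift_comm]

theorem tr_zero (k : Fin d) (u : H d) : tr k 0 u = u := by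
  apply Lp.ext
  filter_upwards [coeFn_tr k 0 u] with ξ h1
  rw [h1, shift_zero, ContinuousMap.id_apply]

theorem inner_tr_left (k : Fin d) (t : ℝ) (u v : H d) :
    inner ℝ (tr k t u) v = inner ℝ u (tr k (-t) v) := by
  rw [← (tr k (-t)).inner_map_map (tr k t u), ← tr_add, neg_add_cancel, tr_zero]

theorem tr_mulH (k : Fin d) (t : ℝ) (c : C(Torus d, ℝ)) (u : H d) :
    tr k t (mulH c u) = mulH (trC k t c) (tr k t u) := by
  apply Lp.ext
  filter_upwards [coeFn_tr k t (mulH c u), coeFn_mulH (trC k t c) (tr k t u), coeFn_tr k t u,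
    (measurePreserving_shift k t).quasiMeasurePreserving.ae (coeFn_mulH c u)] with ξ h1 h2 h3 h4
  rw [h1, h2, h3, h4, trC_apply]

theorem tr_ofC (k : Fin d) (t : ℝ) (c : C(Torus d, ℝ)) : tr k t (ofC c) = ofC (trC k t c) := by
  apply Lp.ext
  filter_upwards [coeFn_tr k t (ofC c), coeFn_ofC (trC k t c),
    (measurePreserving_shift k t).quasiMeasurePreserving.ae (coeFn_ofC c)] with ξ h1 h2 h3
  rw [h1, h2, h3, trC_apply]

theorem continuous_tr (k : Fin d) (u : H d) : Continuous fun t => tr k t u :=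
  continuous_const.compMeasurePreservingLp (continuous_shift k) (measurePreserving_shift k)
    (by norm_num)

/-! ### The strong derivative along translations -/

/-- `g` is the derivative in `L²` of the translates of `u` in direction `e_k`. -/
def HasD (k : Fin d) (u g : H d) : Prop := HasDerivAt (fun t => tr k t u) g 0

variable {k j : Fin d} {u v g h : H d}

theorem HasD.unique (h₁ : HasD k u g) (h₂ : HasD k u h) : g = h := HasDerivAt.unique h₁ h₂

theorem HasD.add (h₁ : HasD k u g) (h₂ : HasD k v h) : HasD k (u + v) (g + h) := by
  simpa [HasD] using HasDerivAt.fun_add h₁ h₂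

theorem HasD.smul (r : ℝ) (h₁ : HasD k u g) : HasD k (r • u) (r • g) := by
  simpa [HasD] using HasDerivAt.fun_const_smul r h₁

theorem HasD.sub (h₁ : HasD k u g) (h₂ : HasD k v h) : HasD k (u - v) (g - h) := by
  simpa [HasD] using HasDerivAt.fun_sub h₁ h₂

theorem HasD.sum {ι : Type*} {s : Finset ι} {u g : ι → H d} (h : ∀ i ∈ s, HasD k (u i) (g i)) :
    HasD k (∑ i ∈ s, u i) (∑ i ∈ s, g i) := by
  simpa [HasD] using HasDerivAt.fun_sum h

theorem HasD.tr (h₁ : HasD k u g) (j : Fin d) (t : ℝ) :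
    HasD k (TorusForms.tr j t u) (TorusForms.tr j t g) := by
  have h2 := (TorusForms.tr j t).toContinuousLinearMap.hasFDerivAt.comp_hasDerivAt 0 h₁
  unfold HasD
  simp only [tr_comm k j]
  exact h2

theorem HasD.mulH {c c' : C(Torus d, ℝ)} (hc : HasPD k c c') (hu : HasD k u g) :
    HasD k (TorusForms.mulH c u) (TorusForms.mulH c' u + TorusForms.mulH c g) := by
  have h1 := (TorusForms.mulH (d := d)).hasFDerivAt.comp_hasDerivAt 0 hc
  have h2 := HasDerivAt.clm_apply h1 hu
  simp only [Function.comp, trC_zero, tr_zero, ← tr_mulH] at h2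
  exact h2

theorem HasD.ofC {c c' : C(Torus d, ℝ)} (hc : HasPD k c c') :
    HasD k (TorusForms.ofC c) (TorusForms.ofC c') := by
  have h := (ContinuousMap.toLp 2 (volume : Measure (Torus d)) ℝ).hasFDerivAt.comp_hasDerivAt 0 hc
  unfold HasD
  simp only [tr_ofC]
  exact h

/-- Integration by parts: translations are isometries, so the inner product of the translates of `u`
and `v` is constant in `t`; differentiate it at `0`. -/
theorem HasD.inner_eq_neg (hu : HasD k u g) (hv : HasD k v h) :
    inner ℝ g v = -inner ℝ u h := by
  have h1 := HasDerivAt.inner ℝ hu hv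
  simp only [LinearIsometry.inner_map_map, tr_zero] at h1
  have h2 := h1.unique (hasDerivAt_const (0 : ℝ) (inner ℝ u v))
  linarith

theorem HasD.hasDerivAt (hu : HasD k u g) (t : ℝ) :
    HasDerivAt (fun s => TorusForms.tr k s u) (TorusForms.tr k t g) t := by
  have h1 : HasDerivAt (fun s => TorusForms.tr k (s - t) u) g t := by
    have h2 : HasDerivAt (fun s : ℝ => s - t) 1 t := (hasDerivAt_id t).sub_const t
    have h3 := HasDerivAt.scomp (g₁ := fun s => TorusForms.tr k s u) (h := fun s : ℝ => s - t) t
      (by rw [sub_self]; exact hu) h2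
    simpa [Function.comp_def] using h3
  have h4 := (TorusForms.tr k t).toContinuousLinearMap.hasFDerivAt.comp_hasDerivAt t h1
  convert! h4 using 1
  funext s
  change _ = TorusForms.tr k t (TorusForms.tr k (s - t) u)
  rw [← tr_add, add_sub_cancel]

theorem HasD.norm_tr_sub_le (hu : HasD k u g) (t : ℝ) :
    ‖TorusForms.tr k t u - u‖ ≤ ‖g‖ * |t| := by
  have h := Convex.norm_image_sub_le_of_norm_hasDerivWithin_le
    (f := fun s => TorusForms.tr k s u) (C := ‖g‖) (s := Set.univ)
    (fun s _ => (hu.hasDerivAt s).hasDerivWithinAt)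
    (fun s _ => ((TorusForms.tr k s).norm_map g).le) convex_univ (Set.mem_univ (0 : ℝ))
    (Set.mem_univ t)
  simpa [tr_zero] using h

/-! ### Weak derivatives -/

theorem isWeakDeriv_iff_inner : IsWeakDeriv k u g ↔
    ∀ (φ : Torus d → ℝ) (hφ : IsCk (⊤ : ℕ∞) φ),
      inner ℝ u (ofC (hφ.pderiv smooth_add_one_le k).toC) = -inner ℝ g (ofC hφ.toC) := by
  refine forall₂_congr fun φ hφ => ?_
  have h1 : inner ℝ u (ofC (hφ.pderiv smooth_add_one_le k).toC)
      = ∫ ξ, u ξ * pderiv k φ ξ := by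
    rw [inner_eq_integral]
    refine integral_congr_ae ?_
    filter_upwards [coeFn_ofC (hφ.pderiv smooth_add_one_le k).toC] with ξ h
    rw [h]; rfl
  have h2 : inner ℝ g (ofC hφ.toC) = ∫ ξ, g ξ * φ ξ := by
    rw [inner_eq_integral]
    refine integral_congr_ae ?_
    filter_upwards [coeFn_ofC hφ.toC] with ξ h
    rw [h]; rfl
  rw [h1, h2]

theorem HasD.isWeakDeriv (hu : HasD k u g) : IsWeakDeriv k u g := by
  refine isWeakDeriv_iff_inner.2 fun φ hφ => ?_
  rw [hu.inner_eq_neg (HasD.ofC (hφ.hasPD smooth_add_one_le k)), neg_neg]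

/-- A weak derivative is a strong one: `tr k t u = u + ∫₀ᵗ tr k s g ds` can be checked against
smooth functions, where both sides have the same `t`-derivative and agree at `0`. The right side is
differentiable in norm because translation is strongly continuous. -/
theorem IsWeakDeriv.hasD (hu : IsWeakDeriv k u g) : HasD k u g := by
  rw [isWeakDeriv_iff_inner] at hu
  have hG : ∀ t, HasDerivAt (fun t => ∫ s in (0 : ℝ)..t, tr k s g) (tr k t g) t := fun t =>
    (continuous_tr k g).integral_hasStrictDerivAt 0 t |>.hasDerivAt
  have key : ∀ t, tr k t u = u + ∫ s in (0 : ℝ)..t, tr k s g := by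
    intro t
    refine eq_of_inner_smooth fun c hc => ?_
    have hc' : IsCk (⊤ : ℕ∞) c := hc
    have hF : ∀ s, HasDerivAt (fun s => inner ℝ (tr k s u) (ofC c))
        (inner ℝ (tr k s g) (ofC c)) s := by
      intro s
      have h1 := (HasD.ofC (hc'.hasPD smooth_add_one_le k)).hasDerivAt (-s)
      have h2 := HasDerivAt.scomp (h := fun s : ℝ => -s) s h1 (hasDerivAt_neg s)
      have h3 := HasDerivAt.inner ℝ (hasDerivAt_const s u) h2
      simp only [inner_tr_left]
      convert! h3 using 1
      have h4 := hu _ (hc'.shift k (-s))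
      rw [inner_zero_left, add_zero, neg_one_smul, inner_neg_right, tr_ofC, tr_ofC]
      have e1 : (hc'.shift k (-s)).toC = trC k (-s) c := rfl
      have e2 : ((hc'.shift k (-s)).pderiv smooth_add_one_le k).toC
          = trC k (-s) (hc'.pderiv smooth_add_one_le k).toC := by
        ext ξ
        exact pderiv_shift (by simp) hc' k (-s) ξ
      rw [e1, e2] at h4
      linarith
    have hF' : ∀ s, HasDerivAt ((fun s => inner ℝ (tr k s u) (ofC c)) -
        fun s => inner ℝ (u + ∫ r in (0 : ℝ)..s, tr k r g) (ofC c)) 0 s := by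
      intro s
      have h1 := HasDerivAt.inner ℝ ((hG s).const_add u) (hasDerivAt_const s (ofC c))
      have h2 := (hF s).sub h1
      simpa using h2
    have h0 := is_const_of_deriv_eq_zero (fun s => (hF' s).differentiableAt)
      (fun s => (hF' s).deriv) t 0
    simpa [tr_zero, sub_eq_zero] using h0
  unfold HasD
  have := (hG 0).const_add u
  rw [tr_zero] at this
  exact this.congr_of_eventuallyEq (Eventually.of_forall key)

theorem isWeakDeriv_iff_hasD : IsWeakDeriv k u g ↔ HasD k u g :=
  ⟨IsWeakDeriv.hasD, HasD.isWeakDeriv⟩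

theorem weakDeriv_eq (hu : HasD k u g) : weakDeriv k u = g := by
  have hex : ∃ g : H d, IsWeakDeriv k u g := ⟨g, hu.isWeakDeriv⟩
  rw [weakDeriv, dif_pos hex]
  exact hex.choose_spec.hasD.unique hu

theorem hasD_weakDeriv (hu : u ∈ H1 d) (k : Fin d) : HasD k u (weakDeriv k u) := by
  obtain ⟨g, hg⟩ := hu k
  rw [weakDeriv_eq hg.hasD]
  exact hg.hasD

theorem mem_H1_of_hasD {g : Fin d → H d} (h : ∀ k, HasD k u (g k)) : u ∈ H1 d :=
  fun k => ⟨g k, (h k).isWeakDeriv⟩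

/-- Closedness of the derivative is immediate in the weak formulation, where both sides are
continuous in `u` and `g`. -/
theorem HasD.of_tendsto {ι : Type*} {l : Filter ι} [l.NeBot] {x y : ι → H d}
    (h : ∀ i, HasD k (x i) (y i)) (hx : Tendsto x l (𝓝 u)) (hy : Tendsto y l (𝓝 g)) :
    HasD k u g := by
  rw [← isWeakDeriv_iff_hasD, isWeakDeriv_iff_inner]
  intro φ hφ
  have h1 : ∀ i, _ := fun i => isWeakDeriv_iff_inner.1 (h i).isWeakDeriv φ hφ
  refine tendsto_nhds_unique (hx.inner tendsto_const_nhds) ?_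
  simp only [h1]
  exact (hy.inner tendsto_const_nhds).neg

/-- Second order derivatives commute. -/
theorem HasD.comm {g' m : H d} (hk : HasD k u g) (hj : HasD j u g') (hjk : HasD j g m) :
    HasD k g' m := by
  have h1 : Tendsto (fun t : ℝ => t⁻¹ • (TorusForms.tr j t u - u)) (𝓝[≠] 0) (𝓝 g') := by
    simpa [tr_zero] using (hasDerivAt_iff_tendsto_slope_zero.1 hj)
  have h2 : Tendsto (fun t : ℝ => t⁻¹ • (TorusForms.tr j t g - g)) (𝓝[≠] 0) (𝓝 m) := by
    simpa [tr_zero] using (hasDerivAt_iff_tendsto_slope_zero.1 hjk)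
  -- The `j`-difference quotients of `u` have the `j`-difference quotients of `g` as
  -- `k`-derivatives; closedness passes to the limit.
  exact HasD.of_tendsto (fun t => ((hk.tr j t).sub hk).smul t⁻¹) h1 h2

/-- Bounded difference quotients imply weak differentiability. -/
theorem exists_hasD_of_bounded {C : ℝ}
    (h : ∀ᶠ t : ℝ in 𝓝[≠] 0, ‖t⁻¹ • (tr k t u - u)‖ ≤ C) :
    ∃ g, HasD k u g := by
  -- Along an ultrafilter every bounded scalar family converges, so the weak limit of the difference
  -- quotients exists without extracting a subsequence; Riesz representation then gives the
  -- derivative.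
  let F : Ultrafilter ℝ := Ultrafilter.of (𝓝[≠] (0 : ℝ))
  have hF : (F : Filter ℝ) ≤ 𝓝[≠] 0 := Ultrafilter.of_le _
  have hlim : ∀ v : H d, ∃ r : ℝ, |r| ≤ C * ‖v‖ ∧
      Tendsto (fun t : ℝ => inner ℝ (t⁻¹ • (tr k t u - u)) v) F (𝓝 r) := by
    intro v
    have hc := isCompact_Icc (a := -(C * ‖v‖)) (b := C * ‖v‖)
    obtain ⟨r, hr, hr'⟩ := hc.ultrafilter_le_nhds
      (F.map fun t : ℝ => inner ℝ (t⁻¹ • (tr k t u - u)) v) (by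
        rw [le_principal_iff]
        refine hF ?_
        filter_upwards [h] with t ht
        rw [Set.mem_preimage, Set.mem_Icc, ← abs_le]
        exact (abs_real_inner_le_norm _ _).trans
          (mul_le_mul_of_nonneg_right ht (norm_nonneg v)))
    exact ⟨r, abs_le.2 hr, hr'⟩
  choose f hfC hf using hlim
  let ℓ : H d →ₗ[ℝ] ℝ :=
    { toFun := f
      map_add' := fun v w => tendsto_nhds_unique (hf (v + w)) (by
        simpa only [inner_add_right] using (hf v).add (hf w))
      map_smul' := fun r v => tendsto_nhds_unique (hf (r • v)) (by
        simpa only [inner_smul_right, RingHom.id_apply, smul_eq_mul] using (hf v).const_mul r) }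
  let L : H d →L[ℝ] ℝ := ℓ.mkContinuous C hfC
  refine ⟨(InnerProductSpace.toDual ℝ (H d)).symm L, IsWeakDeriv.hasD ?_⟩
  rw [isWeakDeriv_iff_inner]
  intro φ hφ
  rw [InnerProductSpace.toDual_symm_apply]
  have hD : HasDerivAt (fun t => inner ℝ (tr k t u) (ofC hφ.toC))
      (-inner ℝ u (ofC (hφ.pderiv smooth_add_one_le k).toC)) 0 := by
    have h1 : HasDerivAt (fun t => tr k t (ofC hφ.toC))
        (ofC (hφ.pderiv smooth_add_one_le k).toC) (-0) := by
      rw [neg_zero]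
      exact HasD.ofC (hφ.hasPD smooth_add_one_le k)
    have h2 := HasDerivAt.scomp (h := fun s : ℝ => -s) 0 h1 (hasDerivAt_neg 0)
    have h3 := HasDerivAt.inner ℝ (hasDerivAt_const (0 : ℝ) u) h2
    simp only [inner_tr_left]
    simpa using h3
  have h1 := (hasDerivAt_iff_tendsto_slope_zero.1 hD).mono_left hF
  have h2 := tendsto_nhds_unique (hf (ofC hφ.toC)) (by
    simpa [tr_zero, inner_smul_left, inner_sub_left] using h1)
  change _ = -f (ofC hφ.toC)
  rw [h2, neg_neg]

end TorusForms

end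

noncomputable section

namespace TorusForms

open Filter Topology

variable {d m : ℕ} {n : WithTop ℕ∞} {l : Torus d → Matrix (Fin m) (Fin d) ℝ} {u v w g h : H d}

/-! ### The space `H¹` and the forms -/

theorem smul_mem_H1 (r : ℝ) (hu : u ∈ H1 d) : r • u ∈ H1 d :=
  mem_H1_of_hasD fun k => (hasD_weakDeriv hu k).smul r

theorem sub_mem_H1 (hu : u ∈ H1 d) (hv : v ∈ H1 d) : u - v ∈ H1 d :=
  mem_H1_of_hasD fun k => (hasD_weakDeriv hu k).sub (hasD_weakDeriv hv k)

theorem tr_mem_H1 (hu : u ∈ H1 d) (k : Fin d) (t : ℝ) : tr k t u ∈ H1 d :=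
  mem_H1_of_hasD fun j => (hasD_weakDeriv hu j).tr k t

theorem ofC_mem_H1 {c : C(Torus d, ℝ)} (hc : c ∈ smoothAlg d) : ofC c ∈ H1 d := by
  have hc' : IsCk (⊤ : ℕ∞) c := hc
  exact mem_H1_of_hasD fun k => HasD.ofC (hc'.hasPD smooth_add_one_le k)

theorem eq_of_inner_H1 (h : ∀ w ∈ H1 d, inner ℝ u w = inner ℝ v w) : u = v :=
  eq_of_inner_smooth fun _ hc => h _ (ofC_mem_H1 hc)

theorem coeFn_sum_mulH {ι : Type*} (s : Finset ι) (c : ι → C(Torus d, ℝ)) (g : ι → H d) :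
    (∑ j ∈ s, mulH (c j) (g j) : H d) =ᵐ[volume] fun ξ => ∑ j ∈ s, c j ξ * g j ξ := by
  have h1 : ∀ᵐ ξ ∂(volume : Measure (Torus d)), ∀ j ∈ s, mulH (c j) (g j) ξ = c j ξ * g j ξ :=
    (ae_ball_iff s.countable_toSet).2 fun j _ => coeFn_mulH (c j) (g j)
  filter_upwards [Lp.coeFn_finsetSum s fun j => mulH (c j) (g j), h1] with ξ h2 h3
  rw [h2, Finset.sum_apply]
  exact Finset.sum_congr rfl h3

theorem rowGrad_ae_eq (hl : IsCkField n l) (i : Fin m) (u : H d) :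
    rowGrad l i u =ᵐ[volume] (∑ j, mulH (hl i j).toC (weakDeriv j u) : H d) :=
  (coeFn_sum_mulH Finset.univ (fun j => (hl i j).toC) fun j => weakDeriv j u).symm

theorem rowGradH_eq (hl : IsCkField n l) (i : Fin m) (u : H d) :
    rowGradH l i u = ∑ j, mulH (hl i j).toC (weakDeriv j u) := by
  have h1 := rowGrad_ae_eq hl i u
  have h2 : MemLp (rowGrad l i u) 2 volume := (memLp_congr_ae h1).2 (Lp.memLp _)
  rw [rowGradH, toH, dif_pos h2]
  exact Lp.ext (h2.coeFn_toLp.trans h1)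

theorem form_eq (hl : IsCkField n l) (u v : H d) :
    form l u v = ∑ i, inner ℝ (rowGradH l i u) (rowGradH l i v) := by
  have h1 : ∀ i, (fun ξ => rowGrad l i u ξ * rowGrad l i v ξ) =ᵐ[volume]
      fun ξ => rowGradH l i u ξ * rowGradH l i v ξ := by
    intro i
    rw [rowGradH_eq hl, rowGradH_eq hl]
    filter_upwards [rowGrad_ae_eq hl i u, rowGrad_ae_eq hl i v] with ξ h1 h2
    rw [h1, h2]
  have h2 : ∀ i, Integrable (fun ξ => rowGradH l i u ξ * rowGradH l i v ξ) volume := fun i =>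
    MemLp.integrable_mul (Lp.memLp (rowGradH l i u)) (Lp.memLp (rowGradH l i v))
  rw [form, integral_finsetSum _ fun i _ => (integrable_congr (h1 i)).2 (h2 i)]
  refine Finset.sum_congr rfl fun i _ => ?_
  rw [inner_eq_integral]
  exact integral_congr_ae (h1 i)

theorem rowGradH_smul (hl : IsCkField n l) (i : Fin m) (r : ℝ) (hu : u ∈ H1 d) :
    rowGradH l i (r • u) = r • rowGradH l i u := by
  simp only [rowGradH_eq hl, weakDeriv_eq ((hasD_weakDeriv hu _).smul r), map_smul,
    Finset.smul_sum]

theorem rowGradH_sub (hl : IsCkField n l) (i : Fin m) (hu : u ∈ H1 d) (hv : v ∈ H1 d) :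
    rowGradH l i (u - v) = rowGradH l i u - rowGradH l i v := by
  simp only [rowGradH_eq hl, weakDeriv_eq ((hasD_weakDeriv hu _).sub (hasD_weakDeriv hv _)),
    map_sub, Finset.sum_sub_distrib]

theorem form_comm (l : Torus d → Matrix (Fin m) (Fin d) ℝ) (u v : H d) :
    form l u v = form l v u := by
  simp only [form, mul_comm]

theorem form_self_nonneg (l : Torus d → Matrix (Fin m) (Fin d) ℝ) (u : H d) :
    0 ≤ form l u u :=
  integral_nonneg fun ξ => Finset.sum_nonneg fun i _ => mul_self_nonneg (rowGrad l i u ξ)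

theorem form_sub_left (hl : IsCkField n l) (hu : u ∈ H1 d) (hv : v ∈ H1 d) (w : H d) :
    form l (u - v) w = form l u w - form l v w := by
  simp only [form_eq hl, rowGradH_sub hl _ hu hv, inner_sub_left, Finset.sum_sub_distrib]

theorem form_smul_left (hl : IsCkField n l) (r : ℝ) (hu : u ∈ H1 d) (w : H d) :
    form l (r • u) w = r * form l u w := by
  simp only [form_eq hl, rowGradH_smul hl _ r hu, real_inner_smul_left, Finset.mul_sum]

/-! ### The weak equation `p v - q L v = u` -/

/-- `p v - q L^l v = u` in the weak sense. -/
def IsRes (l : Torus d → Matrix (Fin m) (Fin d) ℝ) (p q : ℝ) (u v : H d) : Prop :=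
  v ∈ H1 d ∧ ∀ w ∈ H1 d, p * inner ℝ v w + q * form l v w = inner ℝ u w

theorem IsDirichletOp.unique {f f' : H d} (h : IsDirichletOp l v f) (h' : IsDirichletOp l v f') :
    f = f' :=
  eq_of_inner_H1 fun w hw => by linarith [h.2 w hw, h'.2 w hw]

theorem dirichletOp_eq {f : H d} (h : IsDirichletOp l v f) : dirichletOp l v = f := by
  have hex : ∃ f, IsDirichletOp l v f := ⟨f, h⟩
  rw [dirichletOp, dif_pos hex]
  exact hex.choose_spec.unique h

/-- With `(p, q) = (β, 1)` this is the equation of `G_β`, with `(p, q) = (1, δ)` that of `J_δ`; one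
set of lemmas then serves both resolvents. -/
theorem isRes_iff {p q : ℝ} (hq : q ≠ 0) :
    IsRes l p q u v ↔ v ∈ opDomain l ∧ p • v - q • dirichletOp l v = u := by
  constructor
  · rintro ⟨hv, h⟩
    have hD : IsDirichletOp l v (q⁻¹ • (p • v - u)) := by
      refine ⟨hv, fun w hw => ?_⟩
      have := h w hw
      simp only [real_inner_smul_left, inner_sub_left]
      field_simp
      linarith
    refine ⟨⟨_, hD⟩, ?_⟩
    rw [dirichletOp_eq hD, smul_inv_smul₀ hq, sub_sub_cancel]
  · rintro ⟨⟨f, hf⟩, rfl⟩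
    refine ⟨hf.1, fun w hw => ?_⟩
    rw [dirichletOp_eq hf, hf.2 w hw]
    simp only [real_inner_smul_left, inner_sub_left]
    ring

theorem IsRes.sub (hl : IsCkField n l) {p q : ℝ} {u' v' : H d} (h : IsRes l p q u v)
    (h' : IsRes l p q u' v') : IsRes l p q (u - u') (v - v') := by
  refine ⟨sub_mem_H1 h.1 h'.1, fun w hw => ?_⟩
  rw [form_sub_left hl h.1 h'.1, inner_sub_left, inner_sub_left, ← h.2 w hw, ← h'.2 w hw]
  ring

theorem IsRes.smul (hl : IsCkField n l) {p q : ℝ} (r : ℝ) (h : IsRes l p q u v) :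
    IsRes l p q (r • u) (r • v) := by
  refine ⟨smul_mem_H1 r h.1, fun w hw => ?_⟩
  rw [form_smul_left hl r h.1, real_inner_smul_left, real_inner_smul_left, ← h.2 w hw]
  ring

theorem IsRes.unique (hl : IsCkField n l) {p q : ℝ} (hp : 0 < p) (hq : 0 ≤ q)
    (h : IsRes l p q u v) (h' : IsRes l p q u w) : v = w := by
  have h1 := h.sub hl h'
  have h2 := h1.2 _ h1.1
  rw [sub_self, inner_zero_left, real_inner_self_eq_norm_sq] at h2
  have h3 := mul_nonneg hq (form_self_nonneg l (v - w))
  have h4 : ‖v - w‖ ^ 2 = 0 := by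
    nlinarith [sq_nonneg ‖v - w‖]
  rwa [sq_eq_zero_iff, norm_eq_zero, sub_eq_zero] at h4

/-- Resolvents are symmetric. -/
theorem IsRes.inner_comm {p q : ℝ} {u' v' : H d} (h : IsRes l p q u v) (h' : IsRes l p q u' v') :
    inner ℝ u v' = inner ℝ v u' := by
  rw [← h.2 v' h'.1, ← real_inner_comm v u', ← h'.2 v h.1, form_comm, real_inner_comm]

/-- Resolvents commute. -/
theorem IsRes.comm (hl : IsCkField n l) {p₁ q₁ p₂ q₂ : ℝ} (hp₁ : 0 < p₁) (hq₁ : 0 < q₁)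
    {x y : H d} (hv : IsRes l p₁ q₁ u v) (hx : IsRes l p₂ q₂ u x) (hy : IsRes l p₁ q₁ x y) :
    IsRes l p₂ q₂ v y := by
  have h1 := (hv.smul hl q₁).sub hl (hy.smul hl (p₂ * q₁ - q₂ * p₁))
  -- Resolvent identity: `q₁ v - (p₂ q₁ - q₂ p₁) y` and `q₂ x` solve the same equation, hence
  -- coincide. Substituting this in the equation for `y` gives `q₁` times the claim.
  have h2 : IsRes l p₁ q₁ (q₁ • u - (p₂ * q₁ - q₂ * p₁) • x) (q₂ • x) := by
    refine ⟨smul_mem_H1 _ hx.1, fun w hw => ?_⟩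
    rw [form_smul_left hl _ hx.1, inner_sub_left, real_inner_smul_left, real_inner_smul_left,
      real_inner_smul_left, ← hx.2 w hw]
    ring
  have h3 := h1.unique hl hp₁ hq₁.le h2
  refine ⟨hy.1, fun w hw => ?_⟩
  have h4 := hy.2 w hw
  have h5 : inner ℝ (q₁ • v - (p₂ * q₁ - q₂ * p₁) • y) w = inner ℝ (q₂ • x) w := by rw [h3]
  rw [inner_sub_left, real_inner_smul_left, real_inner_smul_left, real_inner_smul_left,
    ← h4] at h5
  apply mul_left_cancel₀ hq₁.ne'
  linear_combination -h5

/-! ### Existence of solutions -/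

theorem coercive_sum {κ : ℝ} (hl : IsCkField n l)
    (hκ : ∀ (ζ : Fin d → ℝ) (ξ : Torus d),
      κ * ∑ j, ζ j ^ 2 ≤ ∑ i, (Matrix.mulVec (l ξ) ζ i) ^ 2) (g : Fin d → H d) :
    κ * ∑ j, ‖g j‖ ^ 2 ≤ ∑ i, ‖∑ j, mulH (hl i j).toC (g j)‖ ^ 2 := by
  have hint : ∀ x : H d, Integrable (fun ξ => x ξ ^ 2) volume := fun x => (Lp.memLp x).integrable_sq
  have hn : ∀ x : H d, ‖x‖ ^ 2 = ∫ ξ, x ξ ^ 2 := by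
    intro x
    rw [← real_inner_self_eq_norm_sq, inner_eq_integral]
    simp only [sq]
  simp only [hn]
  rw [← integral_finsetSum _ fun j _ => hint _, ← integral_finsetSum _ fun j _ => hint _,
    ← integral_const_mul]
  refine integral_mono_ae ((integrable_finsetSum _ fun j _ => hint _).const_mul κ)
    (integrable_finsetSum _ fun j _ => hint _) ?_
  have h1 : ∀ᵐ ξ ∂(volume : Measure (Torus d)), ∀ i,
      (∑ j, mulH (hl i j).toC (g j) : H d) ξ = ∑ j, l ξ i j * g j ξ :=
    ae_all_iff.2 fun i => coeFn_sum_mulH Finset.univ (fun j => (hl i j).toC) g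
  filter_upwards [h1] with ξ h1
  simp only [h1]
  exact hκ (fun j => g j ξ) ξ

/-- Lax–Milgram on `H¹`, realised as the closed subspace `K` of pairs `(u, ∇u)` in `(L²)^{1+d}`;
ellipticity makes the bilinear form coercive with constant `min p (q κ)`. -/
theorem exists_isRes {κ : ℝ} (hl : IsCkField n l) (hκ0 : 0 < κ)
    (hκ : ∀ (ζ : Fin d → ℝ) (ξ : Torus d),
      κ * ∑ j, ζ j ^ 2 ≤ ∑ i, (Matrix.mulVec (l ξ) ζ i) ^ 2)
    {p q : ℝ} (hp : 0 < p) (hq : 0 < q) (u : H d) : ∃ v, IsRes l p q u v := by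
  let E := PiLp 2 fun _ : Option (Fin d) => H d
  let K : Submodule ℝ E :=
    { carrier := {x | ∀ k, HasD k (x none) (x (some k))}
      add_mem' := fun hx hy k => (hx k).add (hy k)
      zero_mem' := fun k => by
        simpa using (HasD.smul (0 : ℝ) (k := k)
          (hasD_weakDeriv (ofC_mem_H1 (zero_mem (smoothAlg d))) k))
      smul_mem' := fun r x hx k => (hx k).smul r }
  have hK : IsClosed (K : Set E) := by
    refine isClosed_of_closure_subset fun x hx k => ?_
    obtain ⟨s, hs, hsx⟩ := mem_closure_iff_seq_limit.1 hx
    have hcont : ∀ o, Tendsto (fun i => s i o) atTop (𝓝 (x o)) := fun o =>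
      ((PiLp.continuous_apply 2 (fun _ => H d) o).tendsto x).comp hsx
    exact HasD.of_tendsto (fun i => hs i k) (hcont none) (hcont (some k))
  have : CompleteSpace K := hK.completeSpace_coe
  let I : H d →L[ℝ] H d →L[ℝ] ℝ := innerSL ℝ
  let P : Option (Fin d) → K →L[ℝ] H d := fun o => (PiLp.proj 2 (fun _ => H d) o).comp K.subtypeL
  let R : Fin m → K →L[ℝ] H d := fun i => ∑ j, (mulH (hl i j).toC).comp (P (some j))
  let B : K →L[ℝ] K →L[ℝ] ℝ :=
    p • I.bilinearComp (P none) (P none) + q • ∑ i, I.bilinearComp (R i) (R i)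
  have hB : ∀ x y, B x y = p * inner ℝ (P none x) (P none y)
      + q * ∑ i, inner ℝ (R i x) (R i y) := by
    intro x y
    simp [B, I]
    rfl
  have hR : ∀ i x, R i x = ∑ j, mulH (hl i j).toC (P (some j) x) := by
    intro i x
    simp [R]
  have hco : IsCoercive B := by
    refine ⟨min p (q * κ), lt_min hp (mul_pos hq hκ0), fun x => ?_⟩
    have h1 : ‖x‖ * ‖x‖ = ‖P none x‖ ^ 2 + ∑ j, ‖P (some j) x‖ ^ 2 := by
      rw [← sq, ← Fintype.sum_option (fun o => ‖P o x‖ ^ 2)]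
      exact PiLp.norm_sq_eq_of_L2 (fun _ : Option (Fin d) => H d) (x : E)
    rw [mul_assoc, h1, hB]
    simp only [real_inner_self_eq_norm_sq]
    have h2 := coercive_sum hl hκ fun j => P (some j) x
    simp only [← hR] at h2
    have h3 : 0 ≤ ∑ j, ‖P (some j) x‖ ^ 2 := Finset.sum_nonneg fun j _ => sq_nonneg _
    calc min p (q * κ) * (‖P none x‖ ^ 2 + ∑ j, ‖P (some j) x‖ ^ 2)
        ≤ p * ‖P none x‖ ^ 2 + q * κ * ∑ j, ‖P (some j) x‖ ^ 2 := by
          rw [mul_add]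
          exact add_le_add (mul_le_mul_of_nonneg_right (min_le_left _ _) (sq_nonneg _))
            (mul_le_mul_of_nonneg_right (min_le_right _ _) h3)
      _ ≤ _ := by
          rw [mul_assoc]
          gcongr
  let F : K := (InnerProductSpace.toDual ℝ K).symm ((I u).comp (P none))
  let x : K := hco.continuousLinearEquivOfBilin.symm F
  have hx : ∀ y, B x y = inner ℝ u (P none y) := by
    intro y
    rw [← hco.continuousLinearEquivOfBilin_apply, ContinuousLinearEquiv.apply_symm_apply,
      InnerProductSpace.toDual_symm_apply]
    rfl
  have hxD : ∀ k, HasD k (P none x) (P (some k) x) := x.2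
  refine ⟨P none x, mem_H1_of_hasD hxD, fun w hw => ?_⟩
  let y : K := ⟨WithLp.toLp 2 fun o => o.elim w fun k => weakDeriv k w,
    fun k => hasD_weakDeriv hw k⟩
  have h1 := hx y
  have hyn : P none y = w := rfl
  have hys : ∀ k, P (some k) y = weakDeriv k w := fun k => rfl
  rw [hB] at h1
  simp only [hR, hyn, hys] at h1
  rw [← h1, form_eq hl]
  simp only [rowGradH_eq hl, weakDeriv_eq (hxD _)]

end TorusForms

end

noncomputable section

namespace TorusForms

open Filter Topology

variable {d m : ℕ} {n : WithTop ℕ∞} {l : Torus d → Matrix (Fin m) (Fin d) ℝ} {u v w g h : H d}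

/-! ### Regularity -/

/-- The entries of the matrix `l* l`. -/
def IsCkField.gram (hl : IsCkField n l) (j k : Fin d) : C(Torus d, ℝ) :=
  ∑ i, (hl i j).toC * (hl i k).toC

theorem sum_inner_rows (hl : IsCkField n l) (x y : Fin d → H d) :
    ∑ i, inner ℝ (∑ j, mulH (hl i j).toC (x j)) (∑ k, mulH (hl i k).toC (y k))
      = ∑ j, ∑ k, inner ℝ (mulH (hl.gram j k) (x j)) (y k) := by
  have h : ∀ j k, inner ℝ (mulH (hl.gram j k) (x j)) (y k)
      = ∑ i, inner ℝ (mulH (hl i j).toC (x j)) (mulH (hl i k).toC (y k)) := by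
    intro j k
    simp only [IsCkField.gram, map_sum, sum_apply, sum_inner]
    refine Finset.sum_congr rfl fun i _ => ?_
    rw [mul_comm, mulH_mul, inner_mulH]
  simp only [h, sum_inner]
  rw [Finset.sum_comm]
  refine Finset.sum_congr rfl fun j _ => ?_
  rw [Finset.sum_comm]
  simp only [inner_sum]

theorem form_eq_gram (hl : IsCkField n l) (u v : H d) :
    form l u v = ∑ j, ∑ k, inner ℝ (mulH (hl.gram j k) (weakDeriv j u)) (weakDeriv k v) := by
  simp only [form_eq hl, rowGradH_eq hl, sum_inner_rows hl]

/-- The difference quotient in direction `e_k`. -/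
def dq (k : Fin d) (t : ℝ) (u : H d) : H d := t⁻¹ • (tr k t u - u)

theorem dq_mem_H1 (hu : u ∈ H1 d) (k : Fin d) (t : ℝ) : dq k t u ∈ H1 d :=
  smul_mem_H1 _ (sub_mem_H1 (tr_mem_H1 hu k t) hu)

theorem HasD.dq {j : Fin d} (hu : HasD j u g) (k : Fin d) (t : ℝ) :
    HasD j (TorusForms.dq k t u) (TorusForms.dq k t g) :=
  ((hu.tr k t).sub hu).smul t⁻¹

/-- Discrete integration by parts. -/
theorem inner_dq_neg (k : Fin d) (t : ℝ) (u v : H d) :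
    inner ℝ u (dq k (-t) v) = -inner ℝ (dq k t u) v := by
  simp only [dq, real_inner_smul_left, real_inner_smul_right, inner_sub_left, inner_sub_right,
    inner_tr_left, inv_neg]
  ring

theorem norm_dq_le {k : Fin d} (hu : HasD k u g) {t : ℝ} (ht : t ≠ 0) : ‖dq k t u‖ ≤ ‖g‖ := by
  rw [dq, norm_smul, norm_inv, Real.norm_eq_abs, inv_mul_le_iff₀ (abs_pos.2 ht), mul_comm]
  exact hu.norm_tr_sub_le t

theorem dq_mulH (k : Fin d) (t : ℝ) (c : C(Torus d, ℝ)) (u : H d) :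
    dq k t (mulH c u) = mulH c (dq k t u) + mulH (t⁻¹ • (trC k t c - c)) (tr k t u) := by
  simp only [dq, tr_mulH, map_smul, map_sub, smul_apply,
    sub_apply, ← smul_add]
  congr 1
  abel

theorem HasPD.eventually_norm_le {k : Fin d} {c c' : C(Torus d, ℝ)} (hc : HasPD k c c') :
    ∀ᶠ t : ℝ in 𝓝[≠] 0, ‖t⁻¹ • (trC k t c - c)‖ ≤ ‖c'‖ + 1 := by
  have h : Tendsto (fun t : ℝ => t⁻¹ • (trC k t c - c)) (𝓝[≠] 0) (𝓝 c') := by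
    simpa [trC_zero] using hasDerivAt_iff_tendsto_slope_zero.1 hc
  exact h.norm.eventually_le_const (lt_add_one _)

theorem norm_mulH_le (c : C(Torus d, ℝ)) (u : H d) :
    ‖mulH c u‖ ≤ ‖mulH (d := d)‖ * ‖c‖ * ‖u‖ :=
  mulH.le_opNorm₂ c u

/-- The `k`-th partial derivatives of the entries of `l* l`. -/
def IsCkField.dgram (hl : IsCkField n l) (hn : 0 + 1 ≤ n) (k i j : Fin d) : C(Torus d, ℝ) :=
  ∑ p, (((hl p i).pderiv hn k).toC * (hl p j).toC + (hl p i).toC * ((hl p j).pderiv hn k).toC)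

theorem IsCkField.hasPD_gram (hl : IsCkField n l) (hn : 0 + 1 ≤ n) (k i j : Fin d) :
    HasPD k (hl.gram i j) (hl.dgram hn k i j) :=
  HasPD.sum fun _ _ => ((hl _ _).hasPD hn k).mul ((hl _ _).hasPD hn k)

/-- Second order regularity of weak solutions. -/
theorem IsRes.weakDeriv_mem_H1 {κ : ℝ} (hl : IsCkField n l) (hn : 0 + 1 ≤ n) (hκ0 : 0 < κ)
    (hκ : ∀ (ζ : Fin d → ℝ) (ξ : Torus d),
      κ * ∑ j, ζ j ^ 2 ≤ ∑ i, (Matrix.mulVec (l ξ) ζ i) ^ 2)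
    {p q : ℝ} (hp : 0 < p) (hq : 0 < q) (hv : IsRes l p q u v) (j : Fin d) :
    weakDeriv j v ∈ H1 d := by
  intro k
  have hA' := hl.hasPD_gram hn k
  set A' := hl.dgram hn k
  obtain ⟨y, hy⟩ : ∃ y : Fin d → H d, ∀ i, weakDeriv i v = y i := ⟨_, fun _ => rfl⟩
  have hvy : ∀ i, HasD i v (y i) := fun i => hy i ▸ hasD_weakDeriv hv.1 i
  rw [hy]
  -- `C` bounds the commutators of the difference quotient with the coefficients of `l* l`; `K` adds
  -- the contribution of the datum `u`.
  set C : ℝ := ∑ i, ∑ j, ‖mulH (d := d)‖ * (‖A' i j‖ + 1) * ‖y i‖ with hC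
  have hC0 : 0 ≤ C := by positivity
  set K : ℝ := ‖u‖ + q * C with hK
  have hK0 : 0 ≤ K := by positivity
  have hev : ∀ᶠ t : ℝ in 𝓝[≠] 0, ∀ i j,
      ‖t⁻¹ • (trC k t (hl.gram i j) - hl.gram i j)‖ ≤ ‖A' i j‖ + 1 :=
    eventually_all.2 fun i => eventually_all.2 fun j => (hA' i j).eventually_norm_le
  have hbd : ∀ᶠ t : ℝ in 𝓝[≠] 0, ‖t⁻¹ • (tr k t (y j) - y j)‖ ≤ d * K / (q * κ) := by
    filter_upwards [hev, self_mem_nhdsWithin] with t ht ht0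
    have ht0' : t ≠ 0 := ht0
    set S : ℝ := ∑ i, ‖dq k t (y i)‖ with hS
    have hS0 : 0 ≤ S := Finset.sum_nonneg fun i _ => norm_nonneg _
    have hjS : ∀ i, ‖dq k t (y i)‖ ≤ S := fun i =>
      Finset.single_le_sum (f := fun i => ‖dq k t (y i)‖) (fun i _ => norm_nonneg _)
        (Finset.mem_univ i)
    -- Nirenberg's test function: moving the outer quotient across the form leaves minus the form of
    -- `dq k t v` with itself, up to the commutator terms.
    have hw : dq k (-t) (dq k t v) ∈ H1 d := dq_mem_H1 (dq_mem_H1 hv.1 k t) k (-t)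
    have heq := hv.2 _ hw
    have hwy : ∀ i, weakDeriv i (dq k (-t) (dq k t v)) = dq k (-t) (dq k t (y i)) := fun i =>
      weakDeriv_eq (((hvy i).dq k t).dq k (-t))
    rw [form_eq_gram hl] at heq
    simp only [hy, hwy, inner_dq_neg k t, dq_mulH, inner_add_left, Finset.sum_add_distrib,
      Finset.sum_neg_distrib] at heq
    rw [← sum_inner_rows hl, ← inner_dq_neg k t u] at heq
    simp only [real_inner_self_eq_norm_sq] at heq
    have hco := coercive_sum hl hκ fun i => dq k t (y i)
    have h1 : -inner ℝ u (dq k (-t) (dq k t v)) ≤ ‖u‖ * S := by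
      refine (neg_le_abs _).trans ((abs_real_inner_le_norm _ _).trans ?_)
      exact mul_le_mul_of_nonneg_left ((norm_dq_le ((hvy k).dq k t) (neg_ne_zero.2 ht0')).trans
        (hjS k)) (norm_nonneg u)
    have h2 : -∑ i, ∑ j, inner ℝ (mulH (t⁻¹ • (trC k t (hl.gram i j) - hl.gram i j))
        (tr k t (y i))) (dq k t (y j)) ≤ C * S := by
      rw [← Finset.sum_neg_distrib, hC, Finset.sum_mul]
      refine Finset.sum_le_sum fun i _ => ?_
      rw [← Finset.sum_neg_distrib, Finset.sum_mul]
      refine Finset.sum_le_sum fun j _ => ?_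
      refine (neg_le_abs _).trans ((abs_real_inner_le_norm _ _).trans ?_)
      refine mul_le_mul ?_ (hjS j) (norm_nonneg _) (by positivity)
      refine (norm_mulH_le _ _).trans ?_
      rw [LinearIsometry.norm_map]
      gcongr
      exact ht i j
    have h3 : q * κ * ∑ i, ‖dq k t (y i)‖ ^ 2 ≤ K * S := by
      have h4 := mul_le_mul_of_nonneg_left hco hq.le
      have h5 := mul_le_mul_of_nonneg_left h2 hq.le
      have h6 := mul_nonneg hp.le (sq_nonneg ‖dq k t v‖)
      rw [hK]
      linarith
    -- Cauchy–Schwarz converts the quadratic bound into `q κ S² ≤ d K S`; cancelling one factor `S`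
    -- bounds all quotients independently of `t`.
    have h4 : S ^ 2 ≤ d * ∑ i, ‖dq k t (y i)‖ ^ 2 := by
      simpa using sq_sum_le_card_mul_sum_sq (s := Finset.univ) (f := fun i => ‖dq k t (y i)‖)
    refine (hjS j).trans ?_
    rw [le_div_iff₀ (mul_pos hq hκ0)]
    rcases hS0.eq_or_lt with h0 | h0
    · rw [← h0, zero_mul]; positivity
    · refine le_of_mul_le_mul_right ?_ h0
      have h5 := mul_le_mul_of_nonneg_left h4 (mul_pos hq hκ0).le
      have h6 := mul_le_mul_of_nonneg_left h3 (Nat.cast_nonneg (α := ℝ) d)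
      linarith
  obtain ⟨g, hg⟩ := exists_hasD_of_bounded hbd
  exact ⟨g, hg.isWeakDeriv⟩

/-! ### The first order operators given by the rows -/

theorem rowGradH_hasD (hl : IsCkField n l) (hn : 0 + 1 ≤ n) (i : Fin m)
    (hu2 : ∀ j, weakDeriv j u ∈ H1 d) (j : Fin d) :
    HasD j (rowGradH l i u) (∑ k, (mulH ((hl i k).pderiv hn j).toC
      (weakDeriv k u) + mulH (hl i k).toC (weakDeriv j (weakDeriv k u)))) := by
  rw [rowGradH_eq hl]
  exact HasD.sum fun k _ => HasD.mulH ((hl i k).hasPD hn j) (hasD_weakDeriv (hu2 k) j)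

theorem rowGradH_mem_H1 (hl : IsCkField n l) (hn : 0 + 1 ≤ n) (i : Fin m)
    (hu2 : ∀ j, weakDeriv j u ∈ H1 d) : rowGradH l i u ∈ H1 d :=
  mem_H1_of_hasD fun j => rowGradH_hasD hl hn i hu2 j

/-- Divergence free vector fields are skew-symmetric. -/
theorem inner_rowGradH (hl : IsCkField n l) (hn : 0 + 1 ≤ n) (i : Fin m)
    (hdiv : ∀ ξ, ∑ j : Fin d, pderiv j (fun η => l η i j) ξ = 0) (hu : u ∈ H1 d) (hv : v ∈ H1 d) :
    inner ℝ (rowGradH l i u) v = -inner ℝ u (rowGradH l i v) := by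
  have h0 : ∑ k, mulH ((hl i k).pderiv hn k).toC v = 0 := by
    rw [← sum_apply, ← map_sum]
    have : ∑ k, ((hl i k).pderiv hn k).toC = 0 := by
      ext ξ
      simpa [ContinuousMap.sum_apply, IsCk.toC_apply] using hdiv ξ
    rw [this]
    simp
  have h1 : ∀ k, inner ℝ (mulH (hl i k).toC (weakDeriv k u)) v =
      -(inner ℝ u (mulH ((hl i k).pderiv hn k).toC v)
        + inner ℝ u (mulH (hl i k).toC (weakDeriv k v))) := by
    intro k
    rw [inner_mulH, (hasD_weakDeriv hu k).inner_eq_neg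
      (HasD.mulH ((hl i k).hasPD hn k) (hasD_weakDeriv hv k)),
      inner_add_right]
  rw [rowGradH_eq hl, rowGradH_eq hl, sum_inner, inner_sum]
  simp only [h1, Finset.sum_neg_distrib, Finset.sum_add_distrib]
  rw [← inner_sum, h0, inner_zero_right, zero_add]

end TorusForms

end

noncomputable section

namespace TorusForms

variable {d m N : ℕ} {n : WithTop ℕ∞} {a : Torus d → Matrix (Fin m) (Fin d) ℝ}
  {b : Torus d → Matrix (Fin N) (Fin d) ℝ} {u v w f g : H d}

/-! ### Commutation -/

/-- Under the commutation identity for the coefficients, the first order operator given by a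
divergence free row `b_i` is skew-symmetric for the form of `a`. -/
theorem form_rowGradH_add_form_rowGradH (ha : IsCkField n a) (hb : IsCkField n b)
    (hn : 0 + 1 ≤ n) (i : Fin N)
    (hR : ∀ (l j : Fin d) (ξ : Torus d), ∑ k : Fin d, ∑ p : Fin m,
        (b ξ i k * (a ξ p l * pderiv k (fun η => a η p j) ξ
            + a ξ p j * pderiv k (fun η => a η p l) ξ)
          - a ξ p k * (a ξ p j * pderiv k (fun η => b η i l) ξ
            + a ξ p l * pderiv k (fun η => b η i j) ξ)) = 0)
    (hdiv : ∀ ξ, ∑ j : Fin d, pderiv j (fun η => b η i j) ξ = 0)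
    (hg : g ∈ H1 d) (hg2 : ∀ j, weakDeriv j g ∈ H1 d)
    (hw : w ∈ H1 d) (hw2 : ∀ j, weakDeriv j w ∈ H1 d) :
    form a (rowGradH b i g) w + form a g (rowGradH b i w) = 0 := by
  set e : Fin d → C(Torus d, ℝ) := fun k => (hb i k).toC with he
  set e' : Fin d → Fin d → C(Torus d, ℝ) := fun j k => ((hb i k).pderiv hn j).toC with he'
  have hcomm : ∀ {x : H d}, x ∈ H1 d → (∀ j, weakDeriv j x ∈ H1 d) → ∀ j k,
      weakDeriv j (weakDeriv k x) = weakDeriv k (weakDeriv j x) := fun hx hx2 j k =>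
    weakDeriv_eq ((hasD_weakDeriv hx j).comm (hasD_weakDeriv hx k) (hasD_weakDeriv (hx2 j) k))
  let X : Fin d → Fin d → C(Torus d, ℝ) → ℝ := fun l j c =>
    inner ℝ (mulH c (weakDeriv l g)) (weakDeriv j w)
  have hXadd : ∀ l j c c', X l j (c + c') = X l j c + X l j c' := by
    intro l j c c'
    simp only [X, map_add, add_apply, inner_add_left]
  have hXsub : ∀ l j c c', X l j (c - c') = X l j c - X l j c' := by
    intro l j c c'
    simp only [X, map_sub, sub_apply, inner_sub_left]
  have hXsum : ∀ l j (c : Fin d → C(Torus d, ℝ)), X l j (∑ k, c k) = ∑ k, X l j (c k) := by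
    intro l j c
    simp only [X, map_sum, sum_apply, sum_inner]
  -- `X l j c` is the integral of `c ∂_l g ∂_j w`. Expanding `∂_l (b_ik ∂_k g)` leaves one term with
  -- second derivatives of `g`.
  have h1 : form a (rowGradH b i g) w = ∑ l, ∑ j, ∑ k, (X k j (ha.gram l j * e' l k)
      + inner ℝ (mulH (ha.gram l j * e k) (weakDeriv k (weakDeriv l g))) (weakDeriv j w)) := by
    rw [form_eq_gram ha]
    refine Finset.sum_congr rfl fun l _ => Finset.sum_congr rfl fun j _ => ?_
    rw [weakDeriv_eq (rowGradH_hasD hb hn i hg2 l), map_sum, sum_inner]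
    refine Finset.sum_congr rfl fun k _ => ?_
    rw [map_add, inner_add_left, ← mulH_mul, ← mulH_mul, hcomm hg hg2 l k]
  -- Here `∂_k` is moved off `∂_k ∂_j w`, which produces the same second-order term with the
  -- opposite sign; no third derivatives occur.
  have h2 : form a g (rowGradH b i w) = ∑ l, ∑ j, ∑ k, (X l k (ha.gram l j * e' j k)
      - X l j (e' k k * ha.gram l j + e k * ha.dgram hn k l j)
      - inner ℝ (mulH (ha.gram l j * e k) (weakDeriv k (weakDeriv l g))) (weakDeriv j w)) := by
    rw [form_eq_gram ha]
    refine Finset.sum_congr rfl fun l _ => Finset.sum_congr rfl fun j _ => ?_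
    rw [weakDeriv_eq (rowGradH_hasD hb hn i hw2 j), inner_sum]
    refine Finset.sum_congr rfl fun k _ => ?_
    have h3 := (HasD.mulH (((hb i k).hasPD hn k).mul (ha.hasPD_gram hn k l j))
      (hasD_weakDeriv (hg2 l) k)).inner_eq_neg (hasD_weakDeriv (hw2 j) k)
    rw [inner_add_left] at h3
    rw [inner_add_right, ← inner_mulH, ← inner_mulH, ← mulH_mul, ← mulH_mul, hcomm hw hw2 j k,
      mul_comm (ha.gram l j) (e k), mul_comm (ha.gram l j) (e' j k)]
    simp only [X]
    linarith
  -- The total coefficient of `∂_l g ∂_j w`, after relabelling indices: minus the left side of (R),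
  -- minus `div b_i` times the entry of `a* a`.
  have h3 : ∀ l j, ∑ k, (ha.gram k j * e' k l + ha.gram l k * e' k j
      - (e' k k * ha.gram l j + e k * ha.dgram hn k l j)) = 0 := by
    intro l j
    ext ξ
    have hdiv' : (∑ k, e' k k ξ) * ha.gram l j ξ = 0 := by
      rw [show ∑ k, e' k k ξ = 0 from hdiv ξ, zero_mul]
    have hR' := hR l j ξ
    rw [Finset.sum_mul] at hdiv'
    simp only [ContinuousMap.sum_apply, ContinuousMap.sub_apply, ContinuousMap.add_apply,
      ContinuousMap.mul_apply, ContinuousMap.zero_apply]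
    rw [← neg_eq_zero, ← hR', ← sub_eq_zero, ← Finset.sum_neg_distrib, ← Finset.sum_sub_distrib,
      ← hdiv']
    refine Finset.sum_congr rfl fun k _ => ?_
    have h4 : ∑ p : Fin m, (b ξ i k * (a ξ p l * pderiv k (fun η => a η p j) ξ
            + a ξ p j * pderiv k (fun η => a η p l) ξ)
          - a ξ p k * (a ξ p j * pderiv k (fun η => b η i l) ξ
            + a ξ p l * pderiv k (fun η => b η i j) ξ))
        = e k ξ * ha.dgram hn k l j ξ - ha.gram k j ξ * e' k l ξ - ha.gram l k ξ * e' k j ξ := by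
      simp only [IsCkField.dgram, IsCkField.gram, ContinuousMap.sum_apply,
        ContinuousMap.add_apply, ContinuousMap.mul_apply, Finset.mul_sum, Finset.sum_mul,
        ← Finset.sum_sub_distrib, he, he', IsCk.toC_apply]
      refine Finset.sum_congr rfl fun p _ => ?_
      ring
    rw [h4]
    ring
  have h4 : ∑ l, ∑ j, ∑ k, X k j (ha.gram l j * e' l k)
      = ∑ l, ∑ j, ∑ k, X l j (ha.gram k j * e' k l) := by
    rw [Finset.sum_comm]
    conv_rhs => rw [Finset.sum_comm]
    exact Finset.sum_congr rfl fun j _ => Finset.sum_comm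
  have h5 : ∑ l, ∑ j, ∑ k, X l k (ha.gram l j * e' j k)
      = ∑ l, ∑ j, ∑ k, X l j (ha.gram l k * e' k j) :=
    Finset.sum_congr rfl fun l _ => Finset.sum_comm
  have h6 : ∑ l, ∑ j, ∑ k, (X l j (ha.gram k j * e' k l) + X l j (ha.gram l k * e' k j)
      - X l j (e' k k * ha.gram l j + e k * ha.dgram hn k l j)) = 0 := by
    simp only [← hXadd, ← hXsub, ← hXsum, h3]
    simp [X]
  rw [h1, h2]
  simp only [Finset.sum_add_distrib, Finset.sum_sub_distrib] at h6 ⊢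
  rw [h4, h5]
  linarith

end TorusForms

end

/-! ### Resolvents: commutation with the rows of `b`, and the approximate forms -/

noncomputable section

namespace TorusForms

variable {d m N : ℕ} {n : WithTop ℕ∞} {a : Torus d → Matrix (Fin m) (Fin d) ℝ}
  {b : Torus d → Matrix (Fin N) (Fin d) ℝ} {u v f g z : H d}

/-- Solvability rules out the default value `0` in the definition of the resolvent. -/
theorem isRes_resolventG {α : ℝ} (hex : ∃ v, IsRes a α 1 u v) :
    IsRes a α 1 u (resolventG a α u) := by
  have hex' : ∃ v ∈ opDomain a, α • v - dirichletOp a v = u := by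
    obtain ⟨v, hv⟩ := hex
    exact ⟨v, by simpa using (isRes_iff one_ne_zero).1 hv⟩
  rw [isRes_iff one_ne_zero, one_smul, resolventG, dif_pos hex']
  exact hex'.choose_spec

theorem isRes_resolventJ {δ : ℝ} (hδ : δ ≠ 0) (hex : ∃ v, IsRes a 1 δ u v) :
    IsRes a 1 δ u (resolventJ a δ u) := by
  have hex' : ∃ v ∈ opDomain a, v - δ • dirichletOp a v = u := by
    obtain ⟨v, hv⟩ := hex
    exact ⟨v, by simpa using (isRes_iff hδ).1 hv⟩
  rw [isRes_iff hδ, one_smul, resolventJ, dif_pos hex']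
  exact hex'.choose_spec

/-- The first order operator given by a row `b_i` commutes with the resolvents of `L^a`,
when it is skew-symmetric in `L²` and for the form of `a`. -/
theorem IsRes.rowGradH {κ : ℝ} (ha : IsCkField n a) (hb : IsCkField n b) (hn : 0 + 1 ≤ n)
    (hκ0 : 0 < κ)
    (hκ : ∀ (ζ : Fin d → ℝ) (ξ : Torus d),
      κ * ∑ j, ζ j ^ 2 ≤ ∑ i, (Matrix.mulVec (a ξ) ζ i) ^ 2) (i : Fin N)
    (hdiv : ∀ ξ, ∑ j : Fin d, pderiv j (fun η => b η i j) ξ = 0)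
    (hskew : ∀ g w : H d, g ∈ H1 d → (∀ j, weakDeriv j g ∈ H1 d) → w ∈ H1 d →
      (∀ j, weakDeriv j w ∈ H1 d) →
      form a (rowGradH b i g) w + form a g (rowGradH b i w) = 0)
    {p q : ℝ} (hp : 0 < p) (hq : 0 < q) (hf : f ∈ H1 d) (hg : IsRes a p q f g) :
    IsRes a p q (rowGradH b i f) (rowGradH b i g) := by
  obtain ⟨z, hz⟩ := exists_isRes ha hκ0 hκ hp hq (TorusForms.rowGradH b i f)
  suffices TorusForms.rowGradH b i g = z by rwa [this]
  have hg2 := hg.weakDeriv_mem_H1 ha hn hκ0 hκ hp hq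
  -- Skew-symmetry for the form needs `H²` on both sides, so the equation for `B_i g` cannot be
  -- tested directly with all of `H¹`. By duality it suffices to test with solutions `w` for data
  -- `y`: these lie in `H²`, and `y` is arbitrary.
  refine ext_inner_right ℝ fun y => ?_
  obtain ⟨w, hw⟩ := exists_isRes ha hκ0 hκ hp hq y
  have hw2 := hw.weakDeriv_mem_H1 ha hn hκ0 hκ hp hq
  have hBg := rowGradH_mem_H1 hb hn i hg2
  have hBw := rowGradH_mem_H1 hb hn i hw2
  have h1 := hw.2 _ hBg
  have h2 := hg.2 _ hBw
  have h3 := hskew g w hg.1 hg2 hw.1 hw2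
  have h4 := inner_rowGradH hb hn i hdiv hg.1 hw.1
  have h5 := inner_rowGradH hb hn i hdiv hf hw.1
  rw [← hz.inner_comm hw, real_inner_comm, ← h1, h5, ← h2, form_comm, real_inner_comm, h4]
  linear_combination q * h3

theorem approxForm_self_nonneg {α β : ℝ} (hβ : 0 < β) (hα : 0 ≤ α)
    (hg : IsRes a β 1 f (resolventG a β f)) : 0 ≤ approxForm a α β f f := by
  rw [approxForm]
  set s := resolventG a β f
  have h1 := hg.2 s hg.1
  have h2 := form_self_nonneg a s
  -- The bracket `⟨f, s⟩ - β ‖s‖²` equals `form a s s`, by the resolvent equation tested with `s`.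
  have h3 : inner ℝ (f - β • s) f
      = ‖f - β • s‖ ^ 2 + β * (inner ℝ f s - β * ‖s‖ ^ 2) := by
    rw [← real_inner_self_eq_norm_sq, ← real_inner_self_eq_norm_sq]
    simp only [inner_sub_left, inner_sub_right, real_inner_smul_left, real_inner_smul_right,
      real_inner_comm f s]
    ring
  rw [real_inner_self_eq_norm_sq] at h1
  have h4 : 0 ≤ inner ℝ (f - β • s) f := by
    rw [h3]
    have : 0 ≤ inner ℝ f s - β * ‖s‖ ^ 2 := by linarith
    positivity
  have h5 : 0 ≤ inner ℝ f f := real_inner_self_nonneg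
  positivity

theorem approxForm_comm {α β : ℝ} (hf : IsRes a β 1 f (resolventG a β f))
    (hg : IsRes a β 1 g (resolventG a β g)) : approxForm a α β f g = approxForm a α β g f := by
  have h := hf.inner_comm hg
  simp only [approxForm, inner_sub_left, real_inner_smul_left, real_inner_comm f g]
  rw [← h, real_inner_comm f (resolventG a β g)]

end TorusForms

end

/-! ### The main theorem -/

open TorusForms
theorem mainTheorem8 (d N : ℕ) (hd : 1 ≤ d)
    (a : Torus d → Matrix (Fin d) (Fin d) ℝ) (b : Torus d → Matrix (Fin N) (Fin d) ℝ)
    (hE : CondE a) (hR : CondR a b) (hD : CondD b) :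
    ∃ c : ℝ,
      (∀ (u : H d) (δ β α : ℝ), 0 < δ → 0 < β → 0 ≤ α →
        resolventJ a δ u ∈ opDomain b ∧
        ∑ i : Fin N, approxForm a α β (rowGradH b i (resolventJ a δ u))
              (rowGradH b i (resolventJ a δ u))
            + approxForm a α β (resolventJ a δ (dirichletOp b (resolventJ a δ u))) u
          ≤ -c * form a (resolventJ a δ u) (resolventJ a δ u)) ∧
      (∀ u ∈ H1 d, ∀ (δ β α : ℝ), 0 < δ → 0 < β → 0 ≤ α →
        approxForm a α β u (resolventJ a δ (dirichletOp b (resolventJ a δ u)))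
          ≤ max (-c) 0 * form a u u) := by
  obtain ⟨ha, κ, hκ0, hκ⟩ := hE
  obtain ⟨-, -, hR⟩ := hR
  obtain ⟨hb, hD⟩ := hD
  have hn : (0 : WithTop ℕ∞) + 1 ≤ 1 := by simp
  have hskew := fun (i : Fin N) (g w : H d) (hg : g ∈ H1 d) (hg2 : ∀ j, weakDeriv j g ∈ H1 d)
    (hw : w ∈ H1 d) (hw2 : ∀ j, weakDeriv j w ∈ H1 d) =>
    form_rowGradH_add_form_rowGradH ha hb hn i (fun l j ξ => hR l j i ξ) (hD i) hg hg2 hw hw2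
  have hG : ∀ {β : ℝ}, 0 < β → ∀ x : H d, IsRes a β 1 x (resolventG a β x) := fun hβ x =>
    isRes_resolventG (exists_isRes ha hκ0 hκ hβ one_pos x)
  have hJ : ∀ {δ : ℝ}, 0 < δ → ∀ x : H d, IsRes a 1 δ x (resolventJ a δ x) := fun hδ x =>
    isRes_resolventJ hδ.ne' (exists_isRes ha hκ0 hκ one_pos hδ x)
  have hreg : ∀ (u : H d) (δ : ℝ), 0 < δ → ∀ i, rowGradH b i (resolventJ a δ u) ∈ H1 d :=
    fun u δ hδ i => rowGradH_mem_H1 hb hn i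
      ((hJ hδ u).weakDeriv_mem_H1 ha hn hκ0 hκ one_pos hδ)
  -- Each `B_i J_δ u` lies in `H¹` by regularity, so skew-symmetry of `B_i` identifies `L^b J_δ u`
  -- as `∑ B_i B_i J_δ u`.
  have hop : ∀ (u : H d) (δ : ℝ), 0 < δ → IsDirichletOp b (resolventJ a δ u)
      (∑ i, rowGradH b i (rowGradH b i (resolventJ a δ u))) := by
    refine fun u δ hδ => ⟨(hJ hδ u).1, fun w hw => ?_⟩
    rw [form_eq hb, sum_inner, ← Finset.sum_neg_distrib]
    refine Finset.sum_congr rfl fun i _ => ?_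
    rw [inner_rowGradH hb hn i (hD i) (hreg u δ hδ i) hw, neg_neg]
  have key : ∀ (u : H d) (δ β α : ℝ), 0 < δ → 0 < β →
      approxForm a α β (resolventJ a δ (dirichletOp b (resolventJ a δ u))) u
        = -∑ i : Fin N, approxForm a α β (rowGradH b i (resolventJ a δ u))
              (rowGradH b i (resolventJ a δ u)) := by
    intro u δ β α hδ hβ
    have hy := dirichletOp_eq (hop u δ hδ)
    have hF := hreg u δ hδ
    have hv := hJ hδ u
    set v := resolventJ a δ u
    set y := dirichletOp b v
    have h1 := (hJ hδ y).inner_comm hv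
    -- `J_δ` is moved onto `u` past `G_β`, so that only `G_β y` paired with `v = J_δ u` remains.
    have h2 := ((hG hβ y).comm ha hβ one_pos (hJ hδ y) (hG hβ _)).inner_comm hv
    have h3 : inner ℝ y v = -∑ i, inner ℝ (rowGradH b i v) (rowGradH b i v) := by
      rw [hy, sum_inner, ← Finset.sum_neg_distrib]
      exact Finset.sum_congr rfl fun i _ => inner_rowGradH hb hn i (hD i) (hF i) hv.1
    -- `G_β` goes onto `v`, one `B_i` follows by skew-symmetry, and `B_i G_β v = G_β B_i v`.
    have h4 : inner ℝ (resolventG a β y) v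
        = -∑ i, inner ℝ (resolventG a β (rowGradH b i v)) (rowGradH b i v) := by
      rw [← (hG hβ y).inner_comm (hG hβ v), hy, sum_inner, ← Finset.sum_neg_distrib]
      refine Finset.sum_congr rfl fun i _ => ?_
      rw [inner_rowGradH hb hn i (hD i) (hF i) (hG hβ v).1, real_inner_comm,
        ((hG hβ v).rowGradH ha hb hn hκ0 hκ i (hD i) (hskew i) hβ one_pos hv.1).unique ha hβ
          zero_le_one (hG hβ _)]
    simp only [approxForm, inner_sub_left, real_inner_smul_left, Finset.sum_add_distrib,
      ← Finset.mul_sum, Finset.sum_sub_distrib]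
    rw [← h1, ← h2, h3, h4]
    ring
  -- By `key` the two terms of item 1 cancel exactly, so `c = 0`; in item 2 the right side is then
  -- `0`.
  refine ⟨0, fun u δ β α hδ hβ _ => ⟨⟨_, hop u δ hδ⟩, ?_⟩, fun u _ δ β α hδ hβ hα => ?_⟩
  · rw [key u δ β α hδ hβ]
    simp
  · rw [approxForm_comm (hG hβ _) (hG hβ _), key u δ β α hδ hβ]
    have := Finset.sum_nonneg fun (i : Fin N) (_ : i ∈ Finset.univ) =>
      approxForm_self_nonneg (α := α) hβ hα (hG hβ (rowGradH b i (resolventJ a δ u)))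
    simpa using this
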